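/- **Notation.** For $\mathbf s\in\mathbb N^n$ (positive integers) and $\boldsymbol\mu\in\{\pm1\}^n$ put $$\zeta^{(M)}(\mathbf s;\boldsymbol\mu)=\sum_{M\ge k_1>\cdots>k_n>0}\frac{\mu_1^{k_1}\cdots\mu_n^{k_n}}{k_1^{s_1}\cdots k_n^{s_n}},\qquad I^{(\varepsilon)}(\mathbf s;\boldsymbol\mu)=\int_0^{1-\varepsilon}\Big(\frac{dt}{t}\Big)^{s_1-1}\frac{dt}{a_1-t}\cdots\Big(\frac{dt}{t}\Big)^{s_n-1}\frac{dt}{a_n-t},\quad a_i=\prod_{j\le i}\mu_j^{-1}$$ (an iterated integral, the leftmost form belonging to the largest variable). The regularized Euler sums $\zeta_*(\mathbf s;\boldsymbol\mu),\zeta_{\sqcup\!\sqcup}(\mathbf s;\boldsymbol\mu)\in\mathbb R[T]$ are the polynomials with $$\zeta^{(M)}(\mathbf s;\boldsymbol\mu)-\zeta_*(\mathbf s;\boldsymbol\mu)\big|_{T=\log M+\gamma}\to0\ (M\to\infty),\qquad I^{(\varepsilon)}(\mathbf s;\boldsymbol\mu)-\zeta_{\sqcup\!\sqcup}(\mathbf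 s;\boldsymbol\mu)\big|_{T=-\log\varepsilon}\to0\ (\varepsilon\to0^+),$$ where $\gamma$ is Euler's constant. Write $\tilde s=s-1$, $|\mathbf s|=\sum_j s_j$, $\mathbf x^{\tilde{\mathbf s}}=\prod_j x_j^{\tilde s_j}$, $\mathbf p(\boldsymbol\mu)=(\mu_1,\mu_1\mu_2,\dots,\mu_1\cdots\mu_n)$ and $\mathbf q(\boldsymbol\mu)=(\mu_1,\mu_2\mu_1,\dots,\mu_n\mu_{n-1})$. *Shuffle side.* Put $S_{\sqcup\!\sqcup}^{(w)}(\mathbf z;\boldsymbol\xi)=\sum_{|\mathbf s|=w}\mathbf z^{\tilde{\mathbf s}}\,\zeta_{\sqcup\!\sqcup}(\mathbf s;\mathbf q(\boldsymbol\xi))$, and let $$(\mathbf x;\boldsymbol\mu)\sqcup\!\!\sqcup^{(w)}(\mathbf y;\boldsymbol\nu)=\sum S_{\sqcup\!\sqcup}^{(w)}(\kappa(\mathbf z);\boldsymbol\xi),$$ the sum being over all interleavings $(\mathbf z;\boldsymbol\xi)$ of the string of the pairs $(x_i,\mu_i)$ with the string of the pairs $(y_j,\nu_j)$. Here $\kappa$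 adds to each variable of $\mathbf z$ the first variable of the other string that stands to its right, and nothing if there is none. *Stuffle side.* Let $$(\mathbf x;\boldsymbol\mu)*^{(w)}(\mathbf y;\boldsymbol\nu)=\sum S_*^{(w)}(\mathbf z;\boldsymbol\xi),$$ the sum being over all terms obtained from such interleavings by merging some (possibly none) of the adjacent entries $(x_i,\mu_i),(y_j,\nu_j)$, in this order, into single entries $(x_i\otimes y_j,\mu_i\nu_j)$. Here $S_*^{(w)}(\mathbf z;\boldsymbol\xi)=\sum_{|\mathbf s|=w}\mathbf z^{\tilde{\mathbf s}}\,\zeta_*(\mathbf s;\boldsymbol\xi)$ with $s_j\ge2$ whenever $z_j=x_i\otimes y_k$, and $(x\otimes y)^{\tilde s}=\sum_{a+b=s,\ a,b\ge1}x^{\tilde a}y^{\tilde b}$. *Modifying factor.* Let $\delta(\mathbf s,\boldsymbol\mu;\mathbf t,\boldsymbol\nu)=1$ if $(s_1,s_2)=(\mu_1,\mu_2)=(1,1)$ or $(t_1,t_2)=(\nu_1,\nu_2)=(1,1)$, and $0$ otherwise. A condition that involves a second component is false in depth one. **Theorem.** For every $(\mathbf s;\boldsymbol\mu)$ the polynomials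 $\zeta_*(\mathbf s;\boldsymbol\mu)$ and $\zeta_{\sqcup\!\sqcup}(\mathbf s;\boldsymbol\mu)$ exist and are unique. Let $w,d,d'\ge1$ be integers with $w>d+d'$. For all $\boldsymbol\mu\in\{\pm1\}^d$, $\boldsymbol\nu\in\{\pm1\}^{d'}$ and all real $\mathbf x=(x_1,\dots,x_d)$, $\mathbf y=(y_1,\dots,y_{d'})$, one has in $\mathbb R[T]$ $$(\mathbf x;\mathbf p(\boldsymbol\mu))\sqcup\!\!\sqcup^{(w)}(\mathbf y;\mathbf p(\boldsymbol\nu))-\sum_{|\mathbf s|+|\mathbf t|=w}\delta(\mathbf s,\boldsymbol\mu;\mathbf t,\boldsymbol\nu)\,\zeta_{\sqcup\!\sqcup}(\mathbf s;\boldsymbol\mu)\zeta_{\sqcup\!\sqcup}(\mathbf t;\boldsymbol\nu)\,\mathbf x^{\tilde{\mathbf s}}\mathbf y^{\tilde{\mathbf t}}$$ $$=(\mathbf x;\boldsymbol\mu)*^{(w)}(\mathbf y;\boldsymbol\nu)-\sum_{|\mathbf s|+|\mathbf t|=w}\delta(\mathbf s,\boldsymbol\mu;\mathbf t,\boldsymbol\nu)\,\zeta_*(\mathbf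 s;\boldsymbol\mu)\zeta_*(\mathbf t;\boldsymbol\nu)\,\mathbf x^{\tilde{\mathbf s}}\mathbf y^{\tilde{\mathbf t}},$$ where $\mathbf s$ runs over $\mathbb N^d$ and $\mathbf t$ over $\mathbb N^{d'}$. -/

import Mathlib

/-!
Euler sums, their regularizations, and the shuffle / stuffle products of generating functions.

Throughout, an index `(s; μ) = (s₁, …, s_d; μ₁, …, μ_d)` is a list of pairs `(s_j, μ_j)` and a string
of variables with signs `(x; μ)` is a list of pairs `(x_j, μ_j)`; signs `±1` are elements of `ℤˣ`.
Polynomials in `T` are elements of `Polynomial ℝ`.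
-/

namespace EulerSum

noncomputable section

open Filter Topology

/-- The truncated Euler sum
`ζ^(M)(s; μ) = ∑_{M ≥ n₁ > ⋯ > n_d > 0} μ₁^{n₁} ⋯ μ_d^{n_d} / (n₁^{s₁} ⋯ n_d^{s_d})`,
written as a nested sum, the outermost summation variable being `n₁`. -/
def zetaTrunc : List (ℕ × ℤˣ) → ℕ → ℝ
  | [], _ => 1
  | (s, μ) :: l, M =>
      ∑ n ∈ Finset.Icc 1 M, (((μ : ℤ) : ℝ) ^ n / (n : ℝ) ^ s) * zetaTrunc l (n - 1)

/-- The differential forms: `none` is `dt / t`, and `some a` is `dt / (a - t)`. -/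
def form : Option ℤˣ → ℝ → ℝ
  | none, t => 1 / t
  | some a, t => 1 / (((a : ℤ) : ℝ) - t)

/-- The iterated integral `∫_{z > t₁ > ⋯ > t_n > 0} f₁(t₁) dt₁ ⋯ f_n(t_n) dt_n`. -/
def iterInt : List (Option ℤˣ) → ℝ → ℝ
  | [], _ => 1
  | f :: l, z => ∫ t in (0 : ℝ)..z, form f t * iterInt l t

/-- The word `(dt/t)^{s₁-1} dt/(a₁-t) ⋯ (dt/t)^{s_d-1} dt/(a_d-t)` with
`a_i = a · ∏_{j ≤ i} μ_j⁻¹`. -/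
def formWord (a : ℤˣ) : List (ℕ × ℤˣ) → List (Option ℤˣ)
  | [] => []
  | (s, μ) :: l => List.replicate (s - 1) none ++ some (a * μ⁻¹) :: formWord (a * μ⁻¹) l

/-- `I^(ε)(s; μ) = ∫_0^{1-ε} (dt/t)^{s₁-1} dt/(a₁-t) ⋯ (dt/t)^{s_d-1} dt/(a_d-t)`, where
`a_i = ∏_{j ≤ i} μ_j⁻¹`. -/
def intTrunc (l : List (ℕ × ℤˣ)) (ε : ℝ) : ℝ :=
  iterInt (formWord 1 l) (1 - ε)

/-- `P` is the stuffle-regularization of `(s; μ)`: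
`ζ^(M)(s; μ) = P(log M + γ) + o(1)` as `M → ∞`. -/
def IsStuffleReg (l : List (ℕ × ℤˣ)) (P : Polynomial ℝ) : Prop :=
  Tendsto (fun M : ℕ => zetaTrunc l M - P.eval (Real.log M + Real.eulerMascheroniConstant))
    atTop (𝓝 0)

/-- `P` is the shuffle-regularization of `(s; μ)`:
`I^(ε)(s; μ) = P(- log ε) + o(1)` as `ε → 0⁺`. -/
def IsShuffleReg (l : List (ℕ × ℤˣ)) (P : Polynomial ℝ) : Prop :=
  Tendsto (fun ε : ℝ => intTrunc l ε - P.eval (- Real.log ε)) (𝓝[>] 0) (𝓝 0)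

open Classical in
/-- The stuffle-regularized Euler sum `ζ_*(s; μ) ∈ ℝ[T]`. -/
def zetaSt (l : List (ℕ × ℤˣ)) : Polynomial ℝ :=
  if h : ∃ P, IsStuffleReg l P then h.choose else 0

open Classical in
/-- The shuffle-regularized Euler sum `ζ_⧢(s; μ) ∈ ℝ[T]`. -/
def zetaSh (l : List (ℕ × ℤˣ)) : Polynomial ℝ :=
  if h : ∃ P, IsShuffleReg l P then h.choose else 0

/-- The tuples `(s₁, …, s_d)` of positive integers with `s₁ + ⋯ + s_d = w`. -/
def comps (d w : ℕ) : Finset (Fin d → ℕ) :=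
  (Finset.Nat.antidiagonalTuple d w).filter fun s => ∀ i, 1 ≤ s i

/-- `p(μ) = (μ₁, μ₁μ₂, …, μ₁⋯μ_d)`. -/
def pSign {d : ℕ} (μ : Fin d → ℤˣ) : Fin d → ℤˣ :=
  fun i => ∏ j ∈ Finset.Iic i, μ j

/-- `(m₁ c, m₂ m₁, m₃ m₂, …)`. -/
def qAux (c : ℤˣ) : List ℤˣ → List ℤˣ
  | [] => []
  | m :: l => (m * c) :: qAux m l

/-- `q(μ) = (μ₁, μ₂μ₁, μ₃μ₂, …, μ_dμ_{d-1})`. -/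
def qSign (l : List ℤˣ) : List ℤˣ := qAux 1 l

/-- All interleavings of two strings (each occurrence counted once); `Sum.inl` and `Sum.inr` record
which of the two strings a component comes from. The maximal runs of `Sum.inl` and of `Sum.inr` are
the blocks `x(I₁), y(J₁), x(I₂), y(J₂), …`. -/
def shuffles {α β : Type} : List α → List β → List (List (α ⊕ β))
  | [], bs => [bs.map Sum.inr]
  | a :: as, [] => [(a :: as).map Sum.inl]
  | a :: as, b :: bs =>
      (shuffles as (b :: bs)).map (Sum.inl a :: ·) ++ (shuffles (a :: as) bs).map (Sum.inr b :: ·)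
termination_by as bs => as.length + bs.length

/-- The first variable of the first string occurring in the word (`0` if there is none). -/
def firstLeft : List ((ℝ × ℤˣ) ⊕ (ℝ × ℤˣ)) → ℝ
  | [] => 0
  | Sum.inl p :: _ => p.1
  | Sum.inr _ :: l => firstLeft l

/-- The first variable of the second string occurring in the word (`0` if there is none). -/
def firstRight : List ((ℝ × ℤˣ) ⊕ (ℝ × ℤˣ)) → ℝ
  | [] => 0
  | Sum.inl _ :: l => firstRight l
  | Sum.inr p :: _ => p.1

/-- The cloning operator `κ`: to every variable one adds the first variable of the next block, that
is, the next variable of the other string (nothing in the last block). Signs are unchanged. -/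
def clone : List ((ℝ × ℤˣ) ⊕ (ℝ × ℤˣ)) → List (ℝ × ℤˣ)
  | [] => []
  | Sum.inl p :: l => (p.1 + firstRight l, p.2) :: clone l
  | Sum.inr p :: l => (p.1 + firstLeft l, p.2) :: clone l

/-- `S_⧢^(w)(z; ξ) = ∑_{s₁ + ⋯ + s_n = w} z₁^{s₁-1} ⋯ z_n^{s_n-1} ζ_⧢(s; q(ξ))`. -/
def genSh (w : ℕ) (z : List (ℝ × ℤˣ)) : Polynomial ℝ :=
  ∑ s ∈ comps z.length w,
    Polynomial.C (∏ i, (z.get i).1 ^ (s i - 1)) *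
      zetaSh ((List.ofFn s).zip (qSign (z.map Prod.snd)))

/-- The weight `w` shuffle side `(x; μ) ⧢^(w) (y; ν)`. -/
def shuffleSide (w : ℕ) (xs ys : List (ℝ × ℤˣ)) : Polynomial ℝ :=
  ((shuffles xs ys).map fun z => genSh w (clone z)).sum

/-- The entries of a stuffle: a variable `x`, or a convolution `x ⊗ y` of two variables. -/
inductive StVar
  | single (x : ℝ)
  | conv (x y : ℝ)

/-- The value `z^{s-1}` for `s ≥ 1`, where `(x ⊗ y)^{s-1} = ∑_{a + b = s, a, b ≥ 1} x^{a-1} y^{b-1}`.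
This last sum is empty for `s = 1`, so only `s ≥ 2` contributes at an entry `x ⊗ y`. -/
def StVar.pow : StVar → ℕ → ℝ
  | StVar.single x, s => x ^ (s - 1)
  | StVar.conv x y, s => ∑ a ∈ Finset.Icc 1 (s - 1), x ^ (a - 1) * y ^ (s - a - 1)

/-- All terms of the stuffle product of `(x; μ)` and `(y; ν)` (each occurrence counted once): the
interleavings of the two strings in which, moreover, a component `(x_i, μ_i)` immediately followed by
a component `(y_j, ν_j)` may be merged into the single component `(x_i ⊗ y_j, μ_i ν_j)`. -/
def stuffles : List (ℝ × ℤˣ) → List (ℝ × ℤˣ) → List (List (StVar × ℤˣ))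
  | [], bs => [bs.map fun b => (StVar.single b.1, b.2)]
  | a :: as, [] => [(a :: as).map fun a => (StVar.single a.1, a.2)]
  | a :: as, b :: bs =>
      (stuffles as (b :: bs)).map ((StVar.single a.1, a.2) :: ·) ++
      (stuffles (a :: as) bs).map ((StVar.single b.1, b.2) :: ·) ++
      (stuffles as bs).map ((StVar.conv a.1 b.1, a.2 * b.2) :: ·)
termination_by as bs => as.length + bs.length

/-- `S_*^(w)(z; ξ) = ∑_{s₁ + ⋯ + s_n = w} z₁^{s₁-1} ⋯ z_n^{s_n-1} ζ_*(s; ξ)`, with `s_j ≥ 2` whenever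
`z_j` is of the form `x ⊗ y`. -/
def genSt (w : ℕ) (z : List (StVar × ℤˣ)) : Polynomial ℝ :=
  ∑ s ∈ comps z.length w,
    Polynomial.C (∏ i, (z.get i).1.pow (s i)) *
      zetaSt ((List.ofFn s).zip (z.map Prod.snd))

/-- The weight `w` stuffle side `(x; μ) *^(w) (y; ν)`. -/
def stuffleSide (w : ℕ) (xs ys : List (ℝ × ℤˣ)) : Polynomial ℝ :=
  ((stuffles xs ys).map fun z => genSt w z).sum

/-- The list `((a₁, b₁), …, (a_d, b_d))`. -/
def pairs {d : ℕ} {α β : Type} (a : Fin d → α) (b : Fin d → β) : List (α × β) :=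
  List.ofFn fun i => (a i, b i)

/-- `(s₁, s₂) = (μ₁, μ₂) = (1, 1)`; in particular the depth is at least two. -/
def LeadingOnes (l : List (ℕ × ℤˣ)) : Prop :=
  ∃ r, l = (1, 1) :: (1, 1) :: r

open Classical in
/-- `δ(s, μ; t, ν)`. -/
def delta (k l : List (ℕ × ℤˣ)) : Polynomial ℝ :=
  if LeadingOnes k ∨ LeadingOnes l then 1 else 0

/-- The modifying terms
`∑_{|s| + |t| = w} δ(s, μ; t, ν) ζ_♯(s; μ) ζ_♯(t; ν) x₁^{s₁-1} ⋯ x_d^{s_d-1} y₁^{t₁-1} ⋯ y_{d'}^{t_{d'}-1}`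
formed with a given version `Z` of the regularized values `ζ_♯`. -/
def modTerms (Z : List (ℕ × ℤˣ) → Polynomial ℝ) (w : ℕ) {d d' : ℕ}
    (x : Fin d → ℝ) (μ : Fin d → ℤˣ) (y : Fin d' → ℝ) (ν : Fin d' → ℤˣ) : Polynomial ℝ :=
  ∑ m ∈ Finset.HasAntidiagonal.antidiagonal w, ∑ s ∈ comps d m.1, ∑ t ∈ comps d' m.2,
    delta (pairs s μ) (pairs t ν) * (Z (pairs s μ) * Z (pairs t ν)) *
      Polynomial.C ((∏ i, x i ^ (s i - 1)) * ∏ j, y j ^ (t j - 1))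

end

end EulerSum

namespace EulerSum

noncomputable section

open Filter Topology Polynomial

/-! Both sides unfold into products of regularized values. The stuffle side equals the sum of
`ζ_*(s; μ) ζ_*(t; ν) x^(s-1) y^(t-1)` over all `s`, `t` of total weight `w` (`stuffleSide_eq`), and
the shuffle side equals the same sum with `ζ_⧢` (`shuffleSide_eq`). Subtracting the modifying terms
leaves exactly the pairs in which neither index begins with `(1, 1), (1, 1)`. For such indices the
two regularizations coincide (`zetaSh_eq_zetaSt`), so the sides agree term by term.

Comparison of regularizations: every truncated sum is `∑ α_j e_j(M) + O(M^{-1/2})` with `e_j =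
ζ^(M)({1}^j)` (`exists_elemSum_expansion`). The integral `I^(ε)` is the power series at `1 - ε`
whose partial sums of coefficients are the truncated sums, so a quantitative Abel theorem
(`abs_powerSeries_le`) carries the expansion over to `I^(ε)` with the same `α_j` and with `T^j / j!`
in place of `e_j`. On the stuffle side `e_j` is asymptotically a polynomial in the harmonic number.
For `j = 0, 1` both recipes give `1` and `T`, and no other `j` occurs without two leading entries
`(1, 1)`.

Stuffle product: in a product of nested sums, compare the two outermost indices; the three cases are
the recursion defining `stuffles`.

Shuffle product: let `u` mark the weight and let `F` be the generating series of iterated integrals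
of a string with first entry `(z, m)` and tail series `F'`. Then `θF = z u F + u X/(m - X) F'` with
`θ = X d/dX`. By Leibniz a product of two such series has coefficient `(x + y) u`; this is what the
operator `κ` records. Uniqueness of the solution gives the shuffle formula by induction
(`shGen_mul_eq_sum_shuffles`).

Errors are required to decay faster than every power of `T`, since in a product they are multiplied
by polynomials in `T`; a mere `o(1)` would not survive. -/

/-! ### Polynomial regularization along a filter -/

/-- `g` decays faster than every power of `T`. -/
def Negl {α : Type*} (F : Filter α) (T g : α → ℝ) : Prop :=
  ∀ k : ℕ, Tendsto (fun a => g a * T a ^ k) F (𝓝 0)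

/-- `f = P(T)` up to an error which decays faster than every power of `T`. -/
def HasReg {α : Type*} (F : Filter α) (T f : α → ℝ) (P : ℝ[X]) : Prop :=
  Negl F T fun a => f a - P.eval (T a)

section Reg

variable {α : Type*} {F : Filter α} {T f g : α → ℝ} {P Q : ℝ[X]}

lemma Negl.tendsto (h : Negl F T f) : Tendsto f F (𝓝 0) := by simpa using h 0

lemma Negl.add (hf : Negl F T f) (hg : Negl F T g) : Negl F T fun a => f a + g a := by
  intro k
  simpa [add_mul] using (hf k).add (hg k)

lemma Negl.mul (hf : Negl F T f) (hg : Negl F T g) : Negl F T fun a => f a * g a := by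
  intro k
  refine (((hf k).mul hg.tendsto).congr fun a => ?_).trans_eq (by simp)
  ring

lemma Negl.mul_eval (hf : Negl F T f) (Q : ℝ[X]) : Negl F T fun a => f a * Q.eval (T a) := by
  induction Q using Polynomial.induction_on' with
  | add p q hp hq => simpa [mul_add] using hp.add hq
  | monomial n c =>
    intro k
    refine (((hf (n + k)).const_mul c).congr fun a => ?_).trans_eq (by simp)
    simp only [eval_monomial]
    ring

lemma Negl.congr (hf : Negl F T f) (h : ∀ a, f a = g a) : Negl F T g := by
  rwa [show g = f from funext fun a => (h a).symm]

lemma Negl.hasReg_zero (hf : Negl F T f) : HasReg F T f 0 := hf.congr fun a => by simp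

lemma HasReg.tendsto (h : HasReg F T f P) :
    Tendsto (fun a => f a - P.eval (T a)) F (𝓝 0) := Negl.tendsto h

lemma HasReg.congr (hf : HasReg F T f P) (h : ∀ a, f a = g a) : HasReg F T g P := by
  rwa [show g = f from funext fun a => (h a).symm]

lemma HasReg.add (hf : HasReg F T f P) (hg : HasReg F T g Q) :
    HasReg F T (fun a => f a + g a) (P + Q) :=
  (Negl.add hf hg).congr fun a => by rw [eval_add]; ring

lemma HasReg.mul (hf : HasReg F T f P) (hg : HasReg F T g Q) :
    HasReg F T (fun a => f a * g a) (P * Q) :=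
  (((Negl.mul hf hg).add (Negl.mul_eval hg P)).add (Negl.mul_eval hf Q)).congr fun a => by
    rw [eval_mul]; ring

lemma hasReg_const (c : ℝ) : HasReg F T (fun _ => c) (C c) := by
  intro k
  simpa using tendsto_const_nhds

lemma HasReg.const_mul (c : ℝ) (hf : HasReg F T f P) :
    HasReg F T (fun a => c * f a) (C c * P) := (hasReg_const c).mul hf

lemma HasReg.sum {ι : Type*} (s : Finset ι) {f : ι → α → ℝ} {P : ι → ℝ[X]}
    (h : ∀ i ∈ s, HasReg F T (f i) (P i)) :
    HasReg F T (fun a => ∑ i ∈ s, f i a) (∑ i ∈ s, P i) := by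
  classical
  induction s using Finset.induction_on with
  | empty => simpa using hasReg_const (F := F) (T := T) 0
  | insert i s hi ih =>
    simp only [Finset.sum_insert hi]
    exact (h i (by simp)).add (ih fun j hj => h j (by simp [hj]))

lemma HasReg.list_sum {ι : Type*} (l : List ι) {f : ι → α → ℝ} {P : ι → ℝ[X]}
    (h : ∀ i ∈ l, HasReg F T (f i) (P i)) :
    HasReg F T (fun a => (l.map fun i => f i a).sum) (l.map P).sum := by
  induction l with
  | nil => simpa using hasReg_const (F := F) (T := T) 0
  | cons i l ih =>
    simp only [List.map_cons, List.sum_cons]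
    exact (h i (by simp)).add (ih fun j hj => h j (by simp [hj]))

/-- A function asymptotic to `T` may be substituted into polynomials. -/
lemma HasReg.eval (hf : HasReg F T f X) (P : ℝ[X]) : HasReg F T (fun a => P.eval (f a)) P := by
  have hpow : ∀ n : ℕ, HasReg F T (fun a => f a ^ n) (X ^ n) := by
    intro n
    induction n with
    | zero => simpa using hasReg_const (F := F) (T := T) 1
    | succ n ih => simpa [pow_succ] using ih.mul hf
  induction P using Polynomial.induction_on' with
  | add p q hp hq => simpa using hp.add hq
  | monomial n c =>
    simpa [← C_mul_X_pow_eq_monomial] using (hpow n).const_mul c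

/-- A nonconstant polynomial is unbounded along `T → ∞`, so `P - Q` is a constant, and that constant
has limit `0`. Plain `o(1)` errors suffice here. -/
lemma eq_of_tendsto_sub_eval [F.NeBot] (hT : Tendsto T F atTop)
    (hP : Tendsto (fun a => f a - P.eval (T a)) F (𝓝 0))
    (hQ : Tendsto (fun a => f a - Q.eval (T a)) F (𝓝 0)) : P = Q := by
  have h : Tendsto (fun a => (P - Q).eval (T a)) F (𝓝 0) := by
    refine ((hQ.sub hP).congr fun a => ?_).trans_eq (by simp)
    rw [eval_sub]; ring
  rw [← sub_eq_zero]
  by_cases hd : 0 < (P - Q).degree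
  · exact absurd (h.abs.trans_eq (by simp))
      (not_tendsto_nhds_of_tendsto_atTop ((Polynomial.abs_tendsto_atTop _ hd).comp hT) 0)
  · rw [eq_C_of_degree_le_zero (not_lt.mp hd)] at h ⊢
    simp only [eval_C] at h
    rw [tendsto_nhds_unique tendsto_const_nhds h, C_0]

lemma HasReg.unique [F.NeBot] (hT : Tendsto T F atTop) (hP : HasReg F T f P)
    (hQ : HasReg F T f Q) : P = Q :=
  eq_of_tendsto_sub_eval hT hP.tendsto hQ.tendsto

end Reg

/-! ### Asymptotics of truncated Euler sums -/

/-- `r = O(n^{-1/2})`. -/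
def Small (r : ℕ → ℝ) : Prop := ∃ C, ∀ n : ℕ, |r n| ≤ C / √(n + 1)

lemma Small.add {r r' : ℕ → ℝ} (h : Small r) (h' : Small r') : Small fun n => r n + r' n := by
  obtain ⟨C, hC⟩ := h
  obtain ⟨C', hC'⟩ := h'
  refine ⟨C + C', fun n => ?_⟩
  rw [add_div]
  exact (abs_add_le _ _).trans (add_le_add (hC n) (hC' n))

lemma Small.const_mul {r : ℕ → ℝ} (c : ℝ) (h : Small r) : Small fun n => c * r n := by
  obtain ⟨C, hC⟩ := h
  refine ⟨|c| * C, fun n => ?_⟩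
  rw [abs_mul, mul_div_assoc]
  exact mul_le_mul_of_nonneg_left (hC n) (abs_nonneg c)

lemma small_zero : Small fun _ => 0 := ⟨0, fun n => by simp⟩

lemma Small.congr {r r' : ℕ → ℝ} (h : Small r) (e : ∀ n, r n = r' n) : Small r' := by
  rwa [show r' = r from funext fun n => (e n).symm]

/-- A telescoping majorant for `x^{-3/2}`; the constant `6` is convenient, not sharp. -/
lemma inv_sqrt_sub_inv_sqrt (x : ℝ) (hx : 1 ≤ x) :
    1 / (x * √x) ≤ 6 / √x - 6 / √(x + 1) := by
  have hx0 : 0 < x := by linarith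
  set a := √x with ha
  set b := √(x + 1) with hb
  have ha0 : 0 < a := Real.sqrt_pos.2 hx0
  have hb0 : 0 < b := Real.sqrt_pos.2 (by linarith)
  have ha2 : a * a = x := Real.mul_self_sqrt hx0.le
  have hb2 : b * b = x + 1 := Real.mul_self_sqrt (by linarith)
  have ha1 : 1 ≤ a := by nlinarith
  have hab : b ≤ 3 / 2 * a := by nlinarith
  rw [div_sub_div _ _ ha0.ne' hb0.ne', div_le_div_iff₀ (by positivity) (by positivity), ← ha2]
  have h1 : (b - a) * (b + a) = 1 := by nlinarith
  have hba : 0 < b - a := by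
    by_contra h
    nlinarith
  have h2 : 1 ≤ (b - a) * (5 / 2 * a) := by
    rw [← h1]
    exact mul_le_mul_of_nonneg_left (by linarith) hba.le
  have h3 : b ≤ 6 * (b - a) * a * a := by
    have := mul_le_mul_of_nonneg_right h2 ha0.le
    nlinarith
  have := mul_le_mul_of_nonneg_left h3 ha0.le
  nlinarith

/-- With the telescoping majorant `g`, the sequence `S - g` increases, `S + g` decreases, and `g →
0`. Their common limit, taken as the supremum of `S - g`, is the constant, and `g` bounds the error.
-/
lemma small_sub_const_of_diff {S : ℕ → ℝ} {C : ℝ}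
    (h : ∀ n : ℕ, |S (n + 1) - S n| ≤ C / ((n + 1) * √(n + 1))) :
    ∃ c, Small fun n => S n - c := by
  have hC : 0 ≤ C := by simpa using (abs_nonneg _).trans (h 0)
  set g : ℕ → ℝ := fun n => C * (6 / √(n + 1)) with hg
  have hgn : ∀ n, 0 ≤ g n := fun n => by positivity
  have hstep : ∀ n, |S (n + 1) - S n| ≤ g n - g (n + 1) := by
    intro n
    refine (h n).trans ?_
    have := mul_le_mul_of_nonneg_left
      (inv_sqrt_sub_inv_sqrt ((n : ℝ) + 1) (by linarith [n.cast_nonneg (α := ℝ)])) hC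
    simp only [hg]
    push_cast
    rw [← mul_sub, div_eq_mul_one_div]
    exact this
  have hlo : Monotone fun n => S n - g n := monotone_nat_of_le_succ fun n => by
    have := (abs_le.1 (hstep n)).1
    linarith
  have hhi : Antitone fun n => S n + g n := antitone_nat_of_succ_le fun n => by
    have := (abs_le.1 (hstep n)).2
    linarith
  have hle : ∀ m n, S m - g m ≤ S n + g n := fun m n =>
    calc S m - g m ≤ S (max m n) - g (max m n) := hlo (le_max_left _ _)
      _ ≤ S (max m n) + g (max m n) := by linarith [hgn (max m n)]
      _ ≤ S n + g n := hhi (le_max_right _ _)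
  refine ⟨⨆ n, (S n - g n), 6 * C, fun n => ?_⟩
  have h1 : S n - g n ≤ ⨆ n, (S n - g n) :=
    le_ciSup (f := fun n => S n - g n) ⟨S 0 + g 0, by rintro _ ⟨m, rfl⟩; exact hle m 0⟩ n
  have h2 : ⨆ n, (S n - g n) ≤ S n + g n := ciSup_le fun m => hle m n
  have h3 : 6 * C / √((n : ℝ) + 1) = g n := by simp only [hg]; ring
  rw [h3, abs_le]
  constructor <;> linarith

/-! ### Harmonic numbers and growth of truncated sums -/

/-- The harmonic numbers. -/
def harm (n : ℕ) : ℝ := ((harmonic n : ℚ) : ℝ)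

lemma harm_zero : harm 0 = 0 := by simp [harm]

lemma harm_succ (n : ℕ) : harm (n + 1) = harm n + 1 / (n + 1) := by
  simp [harm, harmonic_succ]

lemma harm_mono : Monotone harm := monotone_nat_of_le_succ fun n => by
  rw [harm_succ]
  have : (0 : ℝ) ≤ 1 / (n + 1) := by positivity
  linarith

lemma harm_nonneg (n : ℕ) : 0 ≤ harm n := harm_zero ▸ harm_mono (Nat.zero_le n)

lemma harm_eq_sum (n : ℕ) : harm n = ∑ i ∈ Finset.range n, 1 / ((i : ℝ) + 1) := by
  induction n with
  | zero => simp [harm_zero]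
  | succ n ih => rw [harm_succ, ih, Finset.sum_range_succ]

/-- One term of the exponential series gives `H^{2k} ≤ (2k)! e^H`, while `H_n ≤ 1 + log (n + 1)`
gives `e^H ≤ e (n + 1)`; then take square roots. -/
lemma exists_harm_pow_le (k : ℕ) : ∃ C, ∀ n : ℕ, harm n ^ k ≤ C * √(n + 1) := by
  refine ⟨√((2 * k).factorial * Real.exp 1), fun n => ?_⟩
  have h0 : harm n ≤ 1 + Real.log (n + 1) := by
    rcases Nat.eq_zero_or_pos n with rfl | hn
    · simp [harm_zero]
    · refine (harmonic_le_one_add_log n).trans ?_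
      have : (0 : ℝ) < n := by exact_mod_cast hn
      gcongr
      linarith
  have h1 : harm n ^ (2 * k) ≤ (2 * k).factorial * Real.exp 1 * (n + 1) := by
    have h2 := Real.pow_div_factorial_le_exp (harm n) (harm_nonneg n) (2 * k)
    rw [div_le_iff₀ (by positivity)] at h2
    refine h2.trans ?_
    have h3 : Real.exp (harm n) ≤ Real.exp 1 * (n + 1) := by
      refine (Real.exp_le_exp.2 h0).trans_eq ?_
      rw [Real.exp_add, Real.exp_log (by positivity)]
    calc Real.exp (harm n) * (2 * k).factorial ≤ Real.exp 1 * (n + 1) * (2 * k).factorial := by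
          gcongr
      _ = _ := by ring
  rw [← Real.sqrt_mul (by positivity)]
  refine Real.le_sqrt_of_sq_le ?_
  rw [← pow_mul, mul_comm k 2]
  exact h1

lemma zetaTrunc_cons (s : ℕ) (μ : ℤˣ) (l : List (ℕ × ℤˣ)) (M : ℕ) :
    zetaTrunc ((s, μ) :: l) M =
      ∑ n ∈ Finset.range M, ((μ : ℤ) : ℝ) ^ (n + 1) / ((n : ℝ) + 1) ^ s * zetaTrunc l n := by
  rw [zetaTrunc, Finset.range_eq_Ico, ← Finset.Ico_add_one_right_eq_Icc,
    ← Finset.sum_Ico_add' _ 0 M 1]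
  simp

lemma zetaTrunc_cons_succ (s : ℕ) (μ : ℤˣ) (l : List (ℕ × ℤˣ)) (M : ℕ) :
    zetaTrunc ((s, μ) :: l) (M + 1) = zetaTrunc ((s, μ) :: l) M +
      ((μ : ℤ) : ℝ) ^ (M + 1) / ((M : ℝ) + 1) ^ s * zetaTrunc l M := by
  rw [zetaTrunc_cons, zetaTrunc_cons, Finset.sum_range_succ]

lemma abs_sign_pow (μ : ℤˣ) (n : ℕ) : |((μ : ℤ) : ℝ) ^ n| = 1 := by
  rcases Int.units_eq_one_or μ with rfl | rfl <;> simp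

lemma abs_sign_pow_div_le (μ : ℤˣ) (n s k : ℕ) (hk : k ≤ s) :
    |((μ : ℤ) : ℝ) ^ (n + 1) / ((n : ℝ) + 1) ^ s| ≤ 1 / ((n : ℝ) + 1) ^ k := by
  rw [abs_div, abs_sign_pow, abs_of_nonneg (by positivity)]
  gcongr
  linarith [n.cast_nonneg (α := ℝ)]

/-- Dropping signs and replacing every exponent by `1` leaves nested harmonic sums; enlarging each
inner range to `M` decouples them. -/
lemma abs_zetaTrunc_le (l : List (ℕ × ℤˣ)) (hl : ∀ p ∈ l, 1 ≤ p.1) (M : ℕ) :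
    |zetaTrunc l M| ≤ harm M ^ l.length := by
  induction l generalizing M with
  | nil => simp [zetaTrunc]
  | cons p l ih =>
    obtain ⟨s, μ⟩ := p
    have ih := ih fun p hp => hl p (by simp [hp])
    have hs : 1 ≤ s := hl (s, μ) (by simp)
    rw [zetaTrunc_cons, List.length_cons, pow_succ', harm_eq_sum M, Finset.sum_mul, ← harm_eq_sum]
    refine (Finset.abs_sum_le_sum_abs _ _).trans (Finset.sum_le_sum fun n hn => ?_)
    rw [abs_mul]
    refine mul_le_mul ?_ ((ih n).trans ?_) (abs_nonneg _) (by positivity)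
    · simpa using abs_sign_pow_div_le μ n s 1 hs
    · exact pow_le_pow_left₀ (harm_nonneg n) (harm_mono (Finset.mem_range.1 hn).le) _

lemma exists_abs_zetaTrunc_le (l : List (ℕ × ℤˣ)) (hl : ∀ p ∈ l, 1 ≤ p.1) :
    ∃ C, 0 ≤ C ∧ ∀ n : ℕ, |zetaTrunc l n| ≤ C * √(n + 1) := by
  obtain ⟨C, hC⟩ := exists_harm_pow_le l.length
  refine ⟨C, ?_, fun n => (abs_zetaTrunc_le l hl n).trans (hC n)⟩
  simpa using (pow_nonneg (harm_nonneg 0) _).trans (hC 0)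

lemma sqrt_div_self_eq (n : ℕ) : √((n : ℝ) + 1) / (n + 1) = 1 / √(n + 1) := by
  have h : 0 < √((n : ℝ) + 1) := Real.sqrt_pos.2 (by positivity)
  rw [div_eq_div_iff (by positivity) h.ne', Real.mul_self_sqrt (by positivity), one_mul]

lemma sqrt_div_sq_eq (n : ℕ) : √((n : ℝ) + 1) / (n + 1) ^ 2 = 1 / ((n + 1) * √(n + 1)) := by
  rw [pow_two, ← div_div, sqrt_div_self_eq, div_div, mul_comm]

lemma exists_abs_zetaTrunc_diff_le (l : List (ℕ × ℤˣ)) (hl : ∀ p ∈ l, 1 ≤ p.1) :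
    ∃ C, ∀ n : ℕ, |zetaTrunc l (n + 1) - zetaTrunc l n| ≤ C / √(n + 1) := by
  rcases l with _ | ⟨⟨s, μ⟩, l⟩
  · exact ⟨0, fun n => by simp [zetaTrunc]⟩
  · obtain ⟨C, hC0, hC⟩ := exists_abs_zetaTrunc_le l fun p hp => hl p (by simp [hp])
    refine ⟨C, fun n => ?_⟩
    rw [zetaTrunc_cons_succ, add_sub_cancel_left, abs_mul]
    refine (mul_le_mul (abs_sign_pow_div_le μ n s 1 (hl (s, μ) (by simp))) (hC n) (abs_nonneg _)
      (by positivity)).trans_eq ?_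
    rw [div_eq_mul_one_div C, ← sqrt_div_self_eq]
    ring

/-- The elementary sums `e_j(M) = ζ^(M)({1}^j)`. -/
def elemSum (j : ℕ) : ℕ → ℝ := zetaTrunc (List.replicate j (1, 1))

lemma elemSum_zero (M : ℕ) : elemSum 0 M = 1 := by simp [elemSum, zetaTrunc]

lemma elemSum_succ (j M : ℕ) :
    elemSum (j + 1) M = ∑ n ∈ Finset.range M, 1 / ((n : ℝ) + 1) * elemSum j n := by
  simp [elemSum, List.replicate_succ, zetaTrunc_cons]

lemma elemSum_one (M : ℕ) : elemSum 1 M = harm M := by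
  simp [elemSum_succ, elemSum_zero, harm_eq_sum]

/-- The inner sum is `O(√n)`, so with `s ≥ 2` the increments are `O(n^{-3/2})`. -/
lemma exists_const_of_two_le (s : ℕ) (hs : 2 ≤ s) (μ : ℤˣ) (l : List (ℕ × ℤˣ))
    (hl : ∀ p ∈ l, 1 ≤ p.1) : ∃ c, Small fun M => zetaTrunc ((s, μ) :: l) M - c := by
  obtain ⟨C, hC0, hC⟩ := exists_abs_zetaTrunc_le l hl
  refine small_sub_const_of_diff (C := C) fun n => ?_
  rw [zetaTrunc_cons_succ, add_sub_cancel_left, abs_mul]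
  refine (mul_le_mul (abs_sign_pow_div_le μ n s 2 hs) (hC n) (abs_nonneg _)
      (by positivity)).trans_eq ?_
  rw [div_eq_mul_one_div C, ← sqrt_div_sq_eq]
  ring

lemma small_zetaTrunc_div (l : List (ℕ × ℤˣ)) (hl : ∀ p ∈ l, 1 ≤ p.1) :
    Small fun n => zetaTrunc l n / (n + 1) := by
  obtain ⟨C, hC0, hC⟩ := exists_abs_zetaTrunc_le l hl
  refine ⟨C, fun n => ?_⟩
  rw [abs_div, abs_of_nonneg (by positivity : (0 : ℝ) ≤ n + 1), div_eq_mul_one_div C,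
    ← sqrt_div_self_eq, ← mul_div_assoc]
  gcongr
  exact hC n

/-- Alternating sums converge, by summation by parts. -/
lemma exists_const_of_neg_one (l : List (ℕ × ℤˣ)) (hl : ∀ p ∈ l, 1 ≤ p.1) :
    ∃ c, Small fun M => zetaTrunc ((1, -1) :: l) M - c := by
  obtain ⟨C, hC0, hC⟩ := exists_abs_zetaTrunc_le l hl
  obtain ⟨C', hC'⟩ := exists_abs_zetaTrunc_diff_le l hl
  have hC'0 : 0 ≤ C' := by simpa using (abs_nonneg _).trans (hC' 0)
  set f : ℕ → ℝ := fun n => zetaTrunc l n / (n + 1) with hf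
  -- The corrected sequence is the mean of two consecutive partial sums. Its increments involve `f n
  -- - f (n + 1) = O(n^{-3/2})` rather than `f n = O(n^{-1/2})`.
  obtain ⟨c, hc⟩ := small_sub_const_of_diff (C := C + C')
    (S := fun M => zetaTrunc ((1, -1) :: l) M + (-1) ^ (M + 1) * f M / 2) fun n => by
      have h1 : |f n - f (n + 1)| ≤ (C + C') / ((n + 1) * √(n + 1)) := by
        have e : f n - f (n + 1) = zetaTrunc l n / ((n + 1) * (n + 2)) -
            (zetaTrunc l (n + 1) - zetaTrunc l n) / (n + 2) := by
          simp only [hf]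
          push_cast
          field_simp
          ring
        rw [e, add_div]
        refine (abs_sub _ _).trans (add_le_add ?_ ?_)
        · rw [abs_div, abs_of_nonneg (by positivity : (0 : ℝ) ≤ (n + 1) * (n + 2)),
            div_eq_mul_one_div C, ← sqrt_div_sq_eq, ← mul_div_assoc, pow_two]
          gcongr
          · exact hC n
          · linarith
        · rw [abs_div, abs_of_nonneg (by positivity : (0 : ℝ) ≤ n + 2), mul_comm, ← div_div]
          gcongr
          · exact hC' n
          · linarith
      have e : zetaTrunc ((1, -1) :: l) (n + 1) + (-1) ^ (n + 1 + 1) * f (n + 1) / 2 -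
          (zetaTrunc ((1, -1) :: l) n + (-1) ^ (n + 1) * f n / 2) =
          (-1) ^ (n + 1) * ((f n - f (n + 1)) / 2) := by
        rw [zetaTrunc_cons_succ]
        simp only [hf]
        push_cast
        ring
      rw [e, abs_mul, abs_pow, abs_neg, abs_one, one_pow, one_mul, abs_div, abs_two]
      linarith [abs_nonneg (f n - f (n + 1))]
  obtain ⟨D, hD⟩ := small_zetaTrunc_div l hl
  refine ⟨c, (hc.add (r' := fun M => - ((-1) ^ (M + 1) * f M / 2)) ⟨D, fun n => ?_⟩).congr
    fun n => by ring⟩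
  rw [abs_neg, abs_div, abs_mul, abs_pow, abs_neg, abs_one, one_pow, one_mul, abs_two]
  linarith [hD n, abs_nonneg (f n)]

/-- Summation against `1 / (n + 1)` preserves smallness, up to a constant. -/
lemma Small.exists_sum {r : ℕ → ℝ} (h : Small r) :
    ∃ c, Small fun M => (∑ n ∈ Finset.range M, 1 / ((n : ℝ) + 1) * r n) - c := by
  obtain ⟨C, hC⟩ := h
  refine small_sub_const_of_diff (C := C) fun n => ?_
  rw [Finset.sum_range_succ, add_sub_cancel_left, abs_mul, abs_of_nonneg (by positivity),
    mul_comm ((n : ℝ) + 1), ← div_div, one_div, mul_comm, ← div_eq_mul_inv]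
  gcongr
  exact hC n

/-- Every truncated Euler sum is a combination of the sums `e_j`, up to `O(M^{-1/2})`. -/
lemma exists_elemSum_expansion (l : List (ℕ × ℤˣ)) (hl : ∀ p ∈ l, 1 ≤ p.1) :
    ∃ (N : ℕ) (α : ℕ → ℝ),
      Small (fun M => zetaTrunc l M - ∑ j ∈ Finset.range N, α j * elemSum j M) ∧
      ((∀ r, l ≠ (1, 1) :: r) → N = 1) ∧ (¬ LeadingOnes l → N ≤ 2) := by
  have hconst : ∀ l : List (ℕ × ℤˣ), (∃ c, Small fun M => zetaTrunc l M - c) →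
      ∃ (N : ℕ) (α : ℕ → ℝ),
        Small (fun M => zetaTrunc l M - ∑ j ∈ Finset.range N, α j * elemSum j M) ∧
        ((∀ r, l ≠ (1, 1) :: r) → N = 1) ∧ (¬ LeadingOnes l → N ≤ 2) := by
    rintro l ⟨c, hc⟩
    exact ⟨1, fun _ => c, by simpa [elemSum_zero] using hc, fun _ => rfl, fun _ => one_le_two⟩
  induction l with
  | nil => exact hconst _ ⟨1, by simpa [zetaTrunc] using small_zero⟩
  | cons p l ih =>
    obtain ⟨s, μ⟩ := p
    have hl' : ∀ p ∈ l, 1 ≤ p.1 := fun p hp => hl p (by simp [hp])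
    obtain rfl | hs : 1 = s ∨ 2 ≤ s := (hl (s, μ) (by simp)).eq_or_lt
    · rcases Int.units_eq_one_or μ with rfl | rfl
      · obtain ⟨N, α, h, hN, -⟩ := ih hl'
        obtain ⟨c, hc⟩ := h.exists_sum
        -- Prepending `(1, 1)` turns each `e_j` into `e_{j+1}`, and the summed remainder contributes
        -- a constant, the coefficient of `e_0`.
        refine ⟨N + 1, fun j => Nat.casesOn j c α, hc.congr fun M => ?_,
          fun h => absurd rfl (h l), fun h => ?_⟩
        · rw [zetaTrunc_cons, Finset.sum_range_succ']
          simp only [elemSum_succ, elemSum_zero, mul_sub, Finset.sum_sub_distrib, Finset.mul_sum,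
            mul_one, ← sub_sub]
          rw [Finset.sum_comm]
          simp [mul_left_comm]
        -- Without two leading ones the tail does not begin with `(1, 1)`, so its expansion is a
        -- constant and the new length is exactly `2`.
        · rw [hN fun r hr => h ⟨r, by rw [hr]⟩]
      · exact hconst _ (exists_const_of_neg_one l hl')
    · exact hconst _ (exists_const_of_two_le s hs μ l hl')

/-- A power of the harmonic numbers is integrated by raising the exponent. -/
lemma exists_sum_harm_pow (k : ℕ) : ∃ c, Small fun M =>
    (∑ n ∈ Finset.range M, 1 / ((n : ℝ) + 1) * harm n ^ k) - (harm M ^ (k + 1) / (k + 1) + c) := by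
  -- A discrete derivative: the increment of `H^{k+1}` is `(k+1) H^k / (n+1)` up to a summable
  -- error.
  have hD : ∀ k : ℕ, ∃ B, 0 ≤ B ∧ ∀ n : ℕ,
      |harm (n + 1) ^ (k + 1) - harm n ^ (k + 1) - (k + 1) * harm n ^ k / (n + 1)| ≤
        B * (1 + harm n) ^ k / (n + 1) ^ 2 := by
    intro k
    induction k with
    | zero => exact ⟨0, le_rfl, fun n => by simp [harm_succ]⟩
    | succ k ih =>
      obtain ⟨B, hB, h⟩ := ih
      refine ⟨B + (k + 1), by positivity, fun n => ?_⟩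
      have h0 := harm_nonneg n
      have e : harm (n + 1) ^ (k + 1 + 1) - harm n ^ (k + 1 + 1) -
          ((k + 1 : ℕ) + 1) * harm n ^ (k + 1) / (n + 1) =
          (harm (n + 1) ^ (k + 1) - harm n ^ (k + 1) - (k + 1) * harm n ^ k / (n + 1)) *
            harm (n + 1) + (k + 1) * harm n ^ k / (n + 1) ^ 2 := by
        have hs := harm_succ n
        generalize (n : ℝ) + 1 = x at hs ⊢
        push_cast
        linear_combination (harm n ^ (k + 1) + (k + 1) * harm n ^ k / x) * hs
      have h1 : harm (n + 1) ≤ 1 + harm n := by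
        rw [harm_succ, add_comm]
        gcongr
        rw [div_le_one (by positivity)]
        linarith [n.cast_nonneg (α := ℝ)]
      rw [e]
      refine (abs_add_le _ _).trans ?_
      rw [abs_mul, abs_of_nonneg (harm_nonneg (n + 1)), add_mul B, add_div (B * _)]
      refine add_le_add ?_ ?_
      · calc _ ≤ B * (1 + harm n) ^ k / (n + 1) ^ 2 * (1 + harm n) :=
              mul_le_mul (h n) h1 (harm_nonneg _) (by positivity)
          _ = _ := by ring
      · rw [abs_of_nonneg (by positivity)]
        gcongr
        calc harm n ^ k ≤ (1 + harm n) ^ k := pow_le_pow_left₀ h0 (by linarith) _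
          _ ≤ (1 + harm n) ^ (k + 1) := pow_le_pow_right₀ (by linarith) (Nat.le_succ k)
  obtain ⟨B, hB, h⟩ := hD k
  obtain ⟨A, hA⟩ := exists_harm_pow_le k
  have hA0 : 0 ≤ A := by simpa using (pow_nonneg (harm_nonneg 0) _).trans (hA 0)
  have hA' : ∀ n : ℕ, (1 + harm n) ^ k ≤ 2 ^ k * (1 + A) * √(n + 1) := by
    intro n
    have h1 : (1 : ℝ) ≤ √(n + 1) := Real.one_le_sqrt.2 (by linarith [n.cast_nonneg (α := ℝ)])
    have h0 := harm_nonneg n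
    rcases le_total (harm n) 1 with hn | hn
    · calc (1 + harm n) ^ k ≤ 2 ^ k := pow_le_pow_left₀ (by linarith) (by linarith) _
        _ = 2 ^ k * 1 * 1 := by ring
        _ ≤ 2 ^ k * (1 + A) * √(n + 1) := by gcongr; linarith
    · calc (1 + harm n) ^ k ≤ (2 * harm n) ^ k := pow_le_pow_left₀ (by linarith) (by linarith) _
        _ = 2 ^ k * harm n ^ k := by rw [mul_pow]
        _ ≤ 2 ^ k * (A * √(n + 1)) := by gcongr; exact hA n
        _ ≤ 2 ^ k * ((1 + A) * √(n + 1)) := by gcongr; linarith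
        _ = _ := by ring
  obtain ⟨c, hc⟩ := small_sub_const_of_diff (C := B * (2 ^ k * (1 + A)))
    (S := fun M => (∑ n ∈ Finset.range M, 1 / ((n : ℝ) + 1) * harm n ^ k) -
      harm M ^ (k + 1) / (k + 1)) fun n => by
      have e : (∑ n ∈ Finset.range (n + 1), 1 / ((n : ℝ) + 1) * harm n ^ k) -
          harm (n + 1) ^ (k + 1) / (k + 1) - ((∑ n ∈ Finset.range n, 1 / ((n : ℝ) + 1) *
            harm n ^ k) - harm n ^ (k + 1) / (k + 1)) =
          -((harm (n + 1) ^ (k + 1) - harm n ^ (k + 1) - (k + 1) * harm n ^ k / (n + 1)) /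
            (k + 1)) := by
        rw [Finset.sum_range_succ]
        field_simp
        ring
      rw [e, abs_neg, abs_div, abs_of_nonneg (by positivity : (0 : ℝ) ≤ k + 1)]
      refine (div_le_self (abs_nonneg _) (by linarith [k.cast_nonneg (α := ℝ)])).trans
        ((h n).trans ?_)
      rw [div_eq_mul_one_div _ (((n : ℝ) + 1) * √(n + 1)), ← sqrt_div_sq_eq, ← mul_div_assoc]
      gcongr ?_ / _
      rw [mul_assoc B]
      exact mul_le_mul_of_nonneg_left (hA' n) hB
  exact ⟨c, hc.congr fun M => by ring⟩

lemma exists_sum_eval_harm (P : ℝ[X]) : ∃ Q : ℝ[X], Small fun M =>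
    (∑ n ∈ Finset.range M, 1 / ((n : ℝ) + 1) * P.eval (harm n)) - Q.eval (harm M) := by
  induction P using Polynomial.induction_on' with
  | add p q hp hq =>
    obtain ⟨P, hP⟩ := hp
    obtain ⟨Q, hQ⟩ := hq
    refine ⟨P + Q, (hP.add hQ).congr fun M => ?_⟩
    simp only [eval_add, mul_add, Finset.sum_add_distrib]
    ring
  | monomial k a =>
    obtain ⟨c, hc⟩ := exists_sum_harm_pow k
    refine ⟨C a * (C ((k : ℝ) + 1)⁻¹ * X ^ (k + 1) + C c), (hc.const_mul a).congr fun M => ?_⟩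
    simp only [eval_monomial, eval_mul, eval_add, eval_C, eval_pow, eval_X, mul_sub,
      Finset.mul_sum]
    congr 1
    · exact Finset.sum_congr rfl fun n _ => by ring
    · ring

/-- Each step sums `e_j` against `1/(n+1)`: the polynomial part in `H` sums to another polynomial in
`H` up to a small error, and the small part sums to a constant up to a small error. -/
lemma exists_elemSum_sub_eval_harm (j : ℕ) :
    ∃ P : ℝ[X], Small fun M => elemSum j M - P.eval (harm M) := by
  induction j with
  | zero => exact ⟨1, by simpa [elemSum_zero] using small_zero⟩
  | succ j ih =>
    obtain ⟨P, hP⟩ := ih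
    obtain ⟨c, hc⟩ := hP.exists_sum
    obtain ⟨Q, hQ⟩ := exists_sum_eval_harm P
    refine ⟨Q + C c, (hc.add hQ).congr fun M => ?_⟩
    simp only [elemSum_succ, mul_sub, Finset.sum_sub_distrib, eval_add, eval_C]
    ring

/-- The variable `T = log M + γ` of the stuffle regularization. -/
def logGamma (M : ℕ) : ℝ := Real.log M + Real.eulerMascheroniConstant

lemma tendsto_logGamma : Tendsto logGamma atTop atTop :=
  tendsto_atTop_add_const_right _ _ (Real.tendsto_log_atTop.comp tendsto_natCast_atTop_atTop)

/-- The constant `γ` lies between the increasing sequence `H_n - log (n+1)` and the decreasing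
sequence `H_n - log n`. -/
lemma harm_sub_logGamma {n : ℕ} (hn : n ≠ 0) :
    0 ≤ harm n - logGamma n ∧ harm n - logGamma n ≤ 1 / n := by
  have hn' : (0 : ℝ) < n := by positivity
  constructor
  · have := Real.eulerMascheroniConstant_lt_eulerMascheroniSeq' n
    rw [Real.eulerMascheroniSeq', if_neg hn] at this
    simp only [harm, logGamma]
    linarith
  · have h1 := Real.eulerMascheroniSeq_lt_eulerMascheroniConstant n
    rw [Real.eulerMascheroniSeq] at h1
    have h2 : Real.log (n + 1) - Real.log n ≤ 1 / n := by
      rw [← Real.log_div (by positivity) hn'.ne']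
      refine (Real.log_le_sub_one_of_pos (by positivity)).trans_eq ?_
      field_simp
      ring
    simp only [harm, logGamma]
    linarith

/-- One spare power of `T` is used: `T^{k+1} = O(√n)` makes `r T^k = O(1/T)`. -/
lemma Small.negl {r : ℕ → ℝ} (h : Small r) : Negl atTop logGamma r := by
  intro k
  obtain ⟨C, hC⟩ := h
  obtain ⟨A, hA⟩ := exists_harm_pow_le (k + 1)
  have hC0 : 0 ≤ C := by simpa using (abs_nonneg _).trans (hC 0)
  refine squeeze_zero_norm' (a := fun n => C * A / logGamma n) ?_
    (tendsto_const_nhds.div_atTop tendsto_logGamma)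
  filter_upwards [tendsto_logGamma.eventually_gt_atTop 0, eventually_ne_atTop 0] with n hT hn
  have hs : 0 < √((n : ℝ) + 1) := Real.sqrt_pos.2 (by positivity)
  have h1 : logGamma n ^ (k + 1) ≤ A * √(n + 1) :=
    (pow_le_pow_left₀ hT.le (sub_nonneg.1 (harm_sub_logGamma hn).1) _).trans (hA n)
  rw [Real.norm_eq_abs, abs_mul, abs_of_nonneg (pow_nonneg hT.le k), le_div_iff₀ hT, mul_assoc,
    ← pow_succ]
  calc |r n| * logGamma n ^ (k + 1) ≤ C / √(n + 1) * (A * √(n + 1)) :=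
        mul_le_mul (hC n) h1 (by positivity) (by positivity)
    _ = C * A := by field_simp

lemma hasReg_harm : HasReg atTop logGamma harm X := by
  refine Small.negl (r := fun n => harm n - eval (logGamma n) X) ?_
  obtain ⟨K, hK⟩ : ∃ K, ∀ n : ℕ, |harm n - logGamma n| * √(n + 1) ≤ K := by
    -- The first entry covers `n = 0`, where `Real.log 0 = 0` is a default value; `2` serves all `n
    -- ≥ 1`.
    refine ⟨max |logGamma 0| 2, fun n => ?_⟩
    rcases eq_or_ne n 0 with rfl | hn
    · simp [harm_zero]
    · obtain ⟨h1, h2⟩ := harm_sub_logGamma hn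
      refine le_max_of_le_right ?_
      rw [abs_of_nonneg h1]
      have hn' : (1 : ℝ) ≤ n := by exact_mod_cast Nat.one_le_iff_ne_zero.2 hn
      have h3 : √((n : ℝ) + 1) ≤ 2 * n := by
        rw [Real.sqrt_le_left (by linarith)]
        nlinarith
      calc (harm n - logGamma n) * √(n + 1) ≤ 1 / n * (2 * n) :=
            mul_le_mul h2 h3 (by positivity) (by positivity)
        _ = 2 := by field_simp
  refine ⟨K, fun n => ?_⟩
  simp only [eval_X]
  rw [le_div_iff₀ (Real.sqrt_pos.2 (by positivity))]
  exact hK n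

lemma exists_hasReg_elemSum (j : ℕ) : ∃ P, HasReg atTop logGamma (elemSum j) P := by
  obtain ⟨P, hP⟩ := exists_elemSum_sub_eval_harm j
  refine ⟨0 + P, (hP.negl.hasReg_zero.add (hasReg_harm.eval P)).congr fun M => by ring⟩

/-! ### Power series of the iterated integrals -/

/-- The part of the Euler sum in which the outermost summation variable equals `n`. -/
def coef : List (ℕ × ℤˣ) → ℕ → ℝ
  | [], 0 => 1
  | [], _ + 1 => 0
  | _ :: _, 0 => 0
  | (s, μ) :: l, n + 1 => ((μ : ℤ) : ℝ) ^ (n + 1) / ((n : ℝ) + 1) ^ s * zetaTrunc l n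

lemma coef_zero (l : List (ℕ × ℤˣ)) : coef l 0 = zetaTrunc l 0 := by
  rcases l with _ | ⟨⟨s, μ⟩, l⟩ <;> simp [coef, zetaTrunc]

lemma coef_succ (l : List (ℕ × ℤˣ)) (n : ℕ) :
    coef l (n + 1) = zetaTrunc l (n + 1) - zetaTrunc l n := by
  rcases l with _ | ⟨⟨s, μ⟩, l⟩
  · simp [coef, zetaTrunc]
  · rw [zetaTrunc_cons_succ, coef, add_sub_cancel_left]

/-- This is what makes Abel summation applicable: the partial sums of the power series coefficients
are the truncated Euler sums. -/
lemma sum_coef (l : List (ℕ × ℤˣ)) (M : ℕ) :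
    ∑ n ∈ Finset.range (M + 1), coef l n = zetaTrunc l M := by
  rw [Finset.sum_range_succ', coef_zero]
  simp only [coef_succ]
  rw [Finset.sum_range_sub, sub_add_cancel]

lemma harm_le (n : ℕ) : harm n ≤ n := by
  induction n with
  | zero => simp [harm_zero]
  | succ n ih =>
    rw [harm_succ]
    push_cast
    refine add_le_add ih ?_
    rw [div_le_one (by positivity)]
    linarith [n.cast_nonneg (α := ℝ)]

lemma abs_zetaTrunc_le_pow (l : List (ℕ × ℤˣ)) (hl : ∀ p ∈ l, 1 ≤ p.1) (n : ℕ) :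
    |zetaTrunc l n| ≤ (n : ℝ) ^ l.length :=
  (abs_zetaTrunc_le l hl n).trans (pow_le_pow_left₀ (harm_nonneg n) (harm_le n) _)

lemma summable_zetaTrunc_pow (l : List (ℕ × ℤˣ)) (hl : ∀ p ∈ l, 1 ≤ p.1) {r : ℝ} (h0 : 0 ≤ r)
    (h1 : r < 1) : Summable fun n => |zetaTrunc l n| * r ^ n :=
  (summable_pow_mul_geometric_of_norm_lt_one l.length
    (by rwa [Real.norm_eq_abs, abs_of_nonneg h0])).of_nonneg_of_le (fun n => by positivity)
    fun n => mul_le_mul_of_nonneg_right (abs_zetaTrunc_le_pow l hl n) (by positivity)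

lemma summable_coef_pow (l : List (ℕ × ℤˣ)) (hl : ∀ p ∈ l, 1 ≤ p.1) {r : ℝ} (h0 : 0 ≤ r)
    (h1 : r < 1) : Summable fun n => |coef l n| * r ^ n := by
  have h := summable_zetaTrunc_pow l hl h0 h1
  rw [← summable_nat_add_iff 1] at h ⊢
  refine (h.add ((summable_zetaTrunc_pow l hl h0 h1).mul_right r)).of_nonneg_of_le
    (fun n => by positivity) fun n => ?_
  rw [coef_succ, mul_assoc, ← pow_succ, ← add_mul]
  gcongr
  exact abs_sub _ _

/-- Termwise integration of a power series. -/
lemma hasSum_integral_pow {c : ℕ → ℝ} {z : ℝ} (hz : 0 ≤ z)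
    (hc : Summable fun n => |c n| * z ^ n) {g : ℝ → ℝ}
    (hg : ∀ t, 0 < t → t ≤ z → HasSum (fun n => c n * t ^ n) (g t)) :
    HasSum (fun n : ℕ => c n / (n + 1) * z ^ (n + 1)) (∫ t in (0 : ℝ)..z, g t) := by
  have h := intervalIntegral.hasSum_integral_of_dominated_convergence (a := 0) (b := z)
    (μ := MeasureTheory.volume) (F := fun n t => c n * t ^ n) (f := g)
    (fun n _ => |c n| * z ^ n) (fun n => by fun_prop)
    (fun n => Eventually.of_forall fun t ht => by
      rw [Set.uIoc_of_le hz] at ht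
      rw [Real.norm_eq_abs, abs_mul, abs_pow, abs_of_nonneg ht.1.le]
      gcongr
      · exact ht.1.le
      · exact ht.2)
    (Eventually.of_forall fun t _ => hc) (by simp)
    (Eventually.of_forall fun t ht => by
      rw [Set.uIoc_of_le hz] at ht
      exact hg t ht.1 ht.2)
  refine h.congr_fun fun n => ?_
  rw [intervalIntegral.integral_const_mul, integral_pow, zero_pow (Nat.succ_ne_zero n)]
  ring

lemma sign_mul_self (b : ℤˣ) : ((b : ℤ) : ℝ) * ((b : ℤ) : ℝ) = 1 := by
  rcases Int.units_eq_one_or b with rfl | rfl <;> simp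

lemma sign_sub_ne_zero (b : ℤˣ) {t : ℝ} (h0 : 0 ≤ t) (h1 : t < 1) : ((b : ℤ) : ℝ) - t ≠ 0 := by
  rcases Int.units_eq_one_or b with rfl | rfl
  · simpa using (sub_pos.2 h1).ne'
  · have : -1 - t < 0 := by linarith
    simpa using this.ne

/-- As `b² = 1`, the form `1/(b - t)` expands as `∑ b^{n+1} t^n`, and multiplication by it produces
partial sums of coefficients. -/
lemma hasSum_form_mul (l : List (ℕ × ℤˣ)) (hl : ∀ p ∈ l, 1 ≤ p.1) (b : ℤˣ) {t y : ℝ}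
    (h0 : 0 ≤ t) (h1 : t < 1)
    (h : HasSum (fun n => ((b : ℤ) : ℝ) ^ n * coef l n * t ^ n) y) :
    HasSum (fun n => ((b : ℤ) : ℝ) ^ (n + 1) * zetaTrunc l n * t ^ n) (form (some b) t * y) := by
  have hs : Summable fun n => ((b : ℤ) : ℝ) ^ (n + 1) * zetaTrunc l n * t ^ n :=
    Summable.of_norm ((summable_zetaTrunc_pow l hl h0 h1).congr fun n => by
      rw [Real.norm_eq_abs, abs_mul, abs_mul, abs_sign_pow, one_mul, abs_pow, abs_of_nonneg h0])
  obtain ⟨A, hA⟩ := hs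
  have h2 := (hasSum_nat_add_iff' 1).2 (hA.mul_left ((b : ℤ) : ℝ))
  have h3 := hA.mul_left t
  have h4 := (hasSum_nat_add_iff' 1).2 h
  -- Instead of a Cauchy product, `(b - t) A = y` is checked by comparing coefficients; the constant
  -- terms are split off.
  have h5 : y - zetaTrunc l 0 = ((b : ℤ) : ℝ) * A - zetaTrunc l 0 - t * A := by
    have e := h4.unique ((h2.sub h3).congr_fun fun n => ?_)
    · simpa [coef_zero, ← mul_assoc, sign_mul_self] using e
    · rw [coef_succ]
      have := sign_mul_self b
      linear_combination (((b : ℤ) : ℝ) ^ (n + 1) * zetaTrunc l (n + 1) * t ^ (n + 1)) * (-this)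
  rw [form, show y = (((b : ℤ) : ℝ) - t) * A by linarith, ← mul_assoc,
    one_div_mul_cancel (sign_sub_ne_zero b h0 h1), one_mul]
  exact hA

lemma summable_block (l : List (ℕ × ℤˣ)) (hl : ∀ p ∈ l, 1 ≤ p.1) (b : ℤˣ) (k : ℕ) {z : ℝ}
    (h0 : 0 ≤ z) (h1 : z < 1) :
    Summable fun n : ℕ => |((b : ℤ) : ℝ) ^ (n + 1) * zetaTrunc l n / (n + 1) ^ k| * z ^ n := by
  refine (summable_zetaTrunc_pow l hl h0 h1).of_nonneg_of_le (fun n => by positivity) fun n => ?_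
  refine mul_le_mul_of_nonneg_right ?_ (by positivity)
  rw [abs_div, abs_mul, abs_sign_pow, one_mul,
    abs_of_nonneg (by positivity : (0 : ℝ) ≤ ((n : ℝ) + 1) ^ k)]
  exact div_le_self (abs_nonneg _) (one_le_pow₀ (by linarith [n.cast_nonneg (α := ℝ)]))

/-- Integrating against `dt/(b - t)` gives partial sums divided by `n + 1`, and each further `dt/t`
divides once more by `n + 1`. -/
lemma hasSum_iterInt_block (l : List (ℕ × ℤˣ)) (hl : ∀ p ∈ l, 1 ≤ p.1) (b : ℤˣ)
    (v : List (Option ℤˣ))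
    (hv : ∀ z : ℝ, 0 ≤ z → z < 1 →
      HasSum (fun n => ((b : ℤ) : ℝ) ^ n * coef l n * z ^ n) (iterInt v z)) (k : ℕ) (z : ℝ)
    (h0 : 0 ≤ z) (h1 : z < 1) :
    HasSum (fun n : ℕ => ((b : ℤ) : ℝ) ^ (n + 1) * zetaTrunc l n / (n + 1) ^ (k + 1) * z ^ (n + 1))
      (iterInt (List.replicate k none ++ some b :: v) z) := by
  induction k generalizing z with
  | zero =>
    have h := hasSum_integral_pow h0 (c := fun n => ((b : ℤ) : ℝ) ^ (n + 1) * zetaTrunc l n)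
      (by simpa using summable_block l hl b 0 h0 h1) (g := fun t => form (some b) t * iterInt v t)
      fun t ht ht' => hasSum_form_mul l hl b ht.le (ht'.trans_lt h1)
        (hv t ht.le (ht'.trans_lt h1))
    simpa [iterInt] using h
  | succ k ih =>
    have h := hasSum_integral_pow h0
      (c := fun n : ℕ => ((b : ℤ) : ℝ) ^ (n + 1) * zetaTrunc l n / (n + 1) ^ (k + 1))
      (summable_block l hl b (k + 1) h0 h1)
      (g := fun t => form none t * iterInt (List.replicate k none ++ some b :: v) t)
      fun t ht ht' => by
        refine ((ih t ht.le (ht'.trans_lt h1)).mul_left (1 / t)).congr_fun fun n => ?_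
        rw [pow_succ t]
        field_simp
    rw [List.replicate_succ, List.cons_append, iterInt]
    refine h.congr_fun fun n => ?_
    rw [div_div, ← pow_succ]

/-- The iterated integral is the generating function of the truncation levels of the Euler sum. -/
lemma hasSum_iterInt (l : List (ℕ × ℤˣ)) (hl : ∀ p ∈ l, 1 ≤ p.1) (a : ℤˣ) (z : ℝ)
    (h0 : 0 ≤ z) (h1 : z < 1) :
    HasSum (fun n => ((a : ℤ) : ℝ) ^ n * coef l n * z ^ n) (iterInt (formWord a l) z) := by
  induction l generalizing a z with
  | nil =>
    have h : HasSum (fun n => ((a : ℤ) : ℝ) ^ n * coef [] n * z ^ n) _ :=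
      hasSum_single 0 fun n hn => by
        obtain ⟨m, rfl⟩ := Nat.exists_eq_succ_of_ne_zero hn
        simp [coef]
    simpa [coef, formWord, iterInt] using h
  | cons p l ih =>
    obtain ⟨s, μ⟩ := p
    have hl' : ∀ p ∈ l, 1 ≤ p.1 := fun p hp => hl p (by simp [hp])
    obtain ⟨k, rfl⟩ := Nat.exists_eq_add_of_le' (hl (s, μ) (by simp))
    have h := hasSum_iterInt_block l hl' (a * μ⁻¹) _ (ih hl' (a * μ⁻¹)) k z h0 h1
    rw [formWord, Nat.add_sub_cancel, ← hasSum_nat_add_iff' 1]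
    have e : ∑ i ∈ Finset.range 1, ((a : ℤ) : ℝ) ^ i * coef ((k + 1, μ) :: l) i * z ^ i = 0 := by
      simp [coef]
    rw [e, sub_zero]
    refine h.congr_fun fun n => ?_
    simp only [coef, Int.units_inv_eq_self]
    push_cast
    rw [mul_pow]
    ring

lemma hasSum_intTrunc (l : List (ℕ × ℤˣ)) (hl : ∀ p ∈ l, 1 ≤ p.1) {ε : ℝ} (h0 : 0 < ε)
    (h1 : ε ≤ 1) : HasSum (fun n => coef l n * (1 - ε) ^ n) (intTrunc l ε) := by
  have h2 : 0 ≤ 1 - ε := by linarith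
  have h3 : 1 - ε < 1 := by linarith
  simpa [intTrunc] using hasSum_iterInt l hl 1 (1 - ε) h2 h3

/-! ### Abel summation and existence of the regularizations -/

/-- A quantitative Abel theorem: partial sums of size `O(n^{-1/2})`. -/
lemma abs_powerSeries_le {c : ℕ → ℝ} {C : ℝ}
    (hr : ∀ M : ℕ, |∑ n ∈ Finset.range (M + 1), c n| ≤ C / √(M + 1)) {ε y : ℝ} (h0 : 0 < ε)
    (h1 : ε ≤ 1 / 2) (hy : HasSum (fun n => c n * (1 - ε) ^ n) y) :
    |y| ≤ C * (√ε / 2 + √ε * -Real.log ε) := by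
  have hC : 0 ≤ C := by simpa using (abs_nonneg _).trans (hr 0)
  set z := 1 - ε with hz
  have hz0 : 0 < z := by linarith
  have hz1 : z < 1 := by linarith
  set r : ℕ → ℝ := fun M => ∑ n ∈ Finset.range (M + 1), c n with hrdef
  have hgeo : HasSum (fun M : ℕ => z ^ M) (1 / ε) := by
    have := hasSum_geometric_of_lt_one hz0.le hz1
    rwa [hz, sub_sub_cancel, ← one_div] at this
  have hlog : HasSum (fun M : ℕ => z ^ M / ((M : ℝ) + 1)) (-Real.log ε / z) := by
    have := (Real.hasSum_pow_div_log_of_abs_lt_one (by rwa [abs_of_pos hz0])).div_const z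
    rw [hz, sub_sub_cancel, ← hz] at this
    refine this.congr_fun fun M => ?_
    rw [pow_succ]
    field_simp
  have hsq : 0 < √ε := Real.sqrt_pos.2 h0
  have hsq2 : √ε * √ε = ε := Real.mul_self_sqrt h0.le
  have hbd := ((hgeo.mul_left (√ε / 2)).add (hlog.mul_left (1 / (2 * √ε)))).mul_left C
  have hterm : ∀ M, ‖r M * z ^ M‖ ≤
      C * (√ε / 2 * z ^ M + 1 / (2 * √ε) * (z ^ M / ((M : ℝ) + 1))) := by
    intro M
    rw [Real.norm_eq_abs, abs_mul, abs_of_pos (pow_pos hz0 M)]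
    refine (mul_le_mul_of_nonneg_right (hr M) (pow_pos hz0 M).le).trans ?_
    have hs : 0 < √((M : ℝ) + 1) := Real.sqrt_pos.2 (by positivity)
    have hs2 : √((M : ℝ) + 1) * √((M : ℝ) + 1) = M + 1 := Real.mul_self_sqrt (by positivity)
    -- AM-GM with weight `√ε` trades `1/√(M+1)` for a geometric and a logarithmic series, both
    -- summable in closed form.
    have hag : 1 / √((M : ℝ) + 1) ≤ √ε / 2 + 1 / (2 * √ε) * (1 / ((M : ℝ) + 1)) := by
      rw [show 1 / ((M : ℝ) + 1) = 1 / (√((M : ℝ) + 1) * √((M : ℝ) + 1)) by rw [hs2]]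
      have e : √ε / 2 + 1 / (2 * √ε) * (1 / (√((M : ℝ) + 1) * √((M : ℝ) + 1))) -
          1 / √((M : ℝ) + 1) = (√ε * √((M : ℝ) + 1) - 1) ^ 2 /
            (2 * √ε * (√((M : ℝ) + 1) * √((M : ℝ) + 1))) := by
        field_simp
        ring
      have : 0 ≤ (√ε * √((M : ℝ) + 1) - 1) ^ 2 /
            (2 * √ε * (√((M : ℝ) + 1) * √((M : ℝ) + 1))) := by positivity
      linarith
    calc C / √((M : ℝ) + 1) * z ^ M = C * (1 / √((M : ℝ) + 1) * z ^ M) := by ring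
      _ ≤ C * ((√ε / 2 + 1 / (2 * √ε) * (1 / ((M : ℝ) + 1))) * z ^ M) := by
          gcongr
      _ = _ := by ring
  have hsum : Summable fun M => r M * z ^ M := Summable.of_norm_bounded hbd.summable hterm
  obtain ⟨R, hR⟩ := hsum
  have hRle := tsum_of_norm_bounded hbd hterm
  rw [hR.tsum_eq, Real.norm_eq_abs] at hRle
  -- Summation by parts: multiplying the series of partial sums by `1 - z = ε` recovers the original
  -- series.
  have hyR : y = ε * R := by
    have h2 := (hasSum_nat_add_iff' 1).2 hR
    have h3 := (hasSum_nat_add_iff' 1).2 hy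
    have e := h3.unique ((h2.sub (hR.mul_left z)).congr_fun fun n => ?_)
    · simp [hrdef] at e
      rw [hz] at e
      linear_combination e
    · have : c (n + 1) = r (n + 1) - r n := by
        simp only [hrdef]
        rw [Finset.sum_range_succ _ (n + 1), add_sub_cancel_left]
      rw [this]
      ring
  have hlog0 : 0 ≤ -Real.log ε := by
    rw [neg_nonneg]
    exact Real.log_nonpos h0.le (by linarith)
  rw [hyR, abs_mul, abs_of_pos h0]
  calc ε * |R| ≤ ε * (C * (√ε / 2 * (1 / ε) + 1 / (2 * √ε) * (-Real.log ε / z))) := by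
        gcongr
    _ ≤ ε * (C * (√ε / 2 * (1 / ε) + 1 / (2 * √ε) * (-Real.log ε * 2))) := by
        gcongr
        rw [div_le_iff₀ hz0, mul_assoc]
        exact le_mul_of_one_le_right hlog0 (by linarith)
    _ = C * (√ε / 2 + √ε * -Real.log ε) := by
        have h2 : ε / √ε = √ε := by rw [div_eq_iff hsq.ne', hsq2]
        have h3 : ε * (1 / ε) = 1 := by field_simp
        calc _ = C * (√ε / 2 * (ε * (1 / ε)) + (ε / √ε) * -Real.log ε) := by ring
          _ = _ := by rw [h2, h3, mul_one]

/-- The variable `T = -log ε` of the shuffle regularization. -/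
def negLog (ε : ℝ) : ℝ := -Real.log ε

lemma tendsto_negLog : Tendsto negLog (𝓝[>] 0) atTop :=
  tendsto_neg_atBot_atTop.comp Real.tendsto_log_nhdsGT_zero

/-- In terms of `T = -log ε` one has `√ε = e^{-T/2}`. -/
lemma tendsto_sqrt_mul_negLog_pow (k : ℕ) :
    Tendsto (fun ε => √ε * negLog ε ^ k) (𝓝[>] 0) (𝓝 0) := by
  have h := ((Real.tendsto_pow_mul_exp_neg_atTop_nhds_zero k).comp
    (tendsto_negLog.atTop_div_const (two_pos : (0 : ℝ) < 2))).const_mul (2 ^ k)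
  rw [mul_zero] at h
  refine h.congr' ?_
  filter_upwards [self_mem_nhdsWithin] with ε (hε : 0 < ε)
  have e : Real.exp (-(negLog ε / 2)) = √ε := by
    rw [negLog, Real.sqrt_eq_rpow, Real.rpow_def_of_pos hε]
    ring_nf
  simp only [Function.comp]
  rw [e, div_pow]
  field_simp

lemma iterInt_replicate_one (j : ℕ) (z : ℝ) (h0 : 0 ≤ z) (h1 : z < 1) :
    iterInt (List.replicate j (some 1)) z = (-Real.log (1 - z)) ^ j / j.factorial := by
  induction j generalizing z with
  | zero => simp [iterInt]
  | succ j ih =>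
    have hd : ∀ t ∈ Set.uIcc 0 z, HasDerivAt
        (fun t : ℝ => (-Real.log (1 - t)) ^ (j + 1) / (j + 1).factorial)
        (1 / (1 - t) * ((-Real.log (1 - t)) ^ j / j.factorial)) t := by
      intro t ht
      rw [Set.uIcc_of_le h0] at ht
      have ht1 : 1 - t ≠ 0 := by linarith [ht.2]
      have h2 : HasDerivAt (fun t : ℝ => -Real.log (1 - t)) (1 / (1 - t)) t :=
        (((hasDerivAt_id' t).const_sub 1).log ht1).neg.congr_deriv (by rw [neg_div, neg_neg])
      refine ((h2.pow (j + 1)).div_const ((j + 1).factorial : ℝ)).congr_deriv ?_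
      rw [Nat.factorial_succ]
      push_cast
      field_simp
    rw [List.replicate_succ, iterInt]
    have e : ∀ t ∈ Set.uIcc 0 z, form (some 1) t * iterInt (List.replicate j (some 1)) t =
        1 / (1 - t) * ((-Real.log (1 - t)) ^ j / j.factorial) := by
      intro t ht
      rw [Set.uIcc_of_le h0] at ht
      rw [ih t ht.1 (ht.2.trans_lt h1)]
      simp [form]
    rw [intervalIntegral.integral_congr e, intervalIntegral.integral_eq_sub_of_hasDerivAt hd]
    · simp
    · refine ContinuousOn.intervalIntegrable fun t ht => ContinuousAt.continuousWithinAt ?_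
      rw [Set.uIcc_of_le h0] at ht
      have ht1 : 1 - t ≠ 0 := by linarith [ht.2]
      fun_prop (disch := assumption)

lemma intTrunc_replicate_one (j : ℕ) {ε : ℝ} (h0 : 0 < ε) (h1 : ε ≤ 1) :
    intTrunc (List.replicate j (1, 1)) ε = negLog ε ^ j / j.factorial := by
  have e : formWord 1 (List.replicate j (1, 1)) = List.replicate j (some 1) := by
    induction j with
    | zero => rfl
    | succ j ih => simp [List.replicate_succ, formWord, ih]
  rw [intTrunc, e, iterInt_replicate_one j _ (by linarith) (by linarith), sub_sub_cancel, negLog]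

lemma one_le_of_mem_replicate (j : ℕ) : ∀ p ∈ List.replicate j ((1, 1) : ℕ × ℤˣ), 1 ≤ p.1 :=
  fun p hp => by rw [List.eq_of_mem_replicate hp]

/-- Abel's estimate is applied to the series of `l` minus the combination of the series of `{1}^j`;
the partial sums of the difference are the small remainder. The integrals of `{1}^j` are exactly
`T^j / j!`. -/
lemma hasReg_intTrunc_of_expansion {l : List (ℕ × ℤˣ)} (hl : ∀ p ∈ l, 1 ≤ p.1) {N : ℕ}
    {α : ℕ → ℝ}
    (h : Small fun M => zetaTrunc l M - ∑ j ∈ Finset.range N, α j * elemSum j M) :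
    HasReg (𝓝[>] 0) negLog (intTrunc l)
      (∑ j ∈ Finset.range N, C (α j / j.factorial) * X ^ j) := by
  obtain ⟨A, hA⟩ := h
  intro k
  have hlim := ((tendsto_sqrt_mul_negLog_pow k).const_mul (A / 2)).add
    ((tendsto_sqrt_mul_negLog_pow (k + 1)).const_mul A)
  simp only [mul_zero, add_zero] at hlim
  refine squeeze_zero_norm' ?_ hlim
  filter_upwards [Ioc_mem_nhdsGT (by norm_num : (0 : ℝ) < 1 / 2)] with ε hε
  have h1 : ε ≤ 1 := by linarith [hε.2]
  have hT : 0 ≤ negLog ε := neg_nonneg.2 (Real.log_nonpos hε.1.le h1)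
  have hs := (hasSum_intTrunc l hl hε.1 h1).sub (hasSum_sum (s := Finset.range N) fun j _ =>
    (hasSum_intTrunc _ (one_le_of_mem_replicate j) hε.1 h1).mul_left (α j))
  have hb := abs_powerSeries_le (C := A)
    (c := fun n => coef l n - ∑ j ∈ Finset.range N, α j * coef (List.replicate j (1, 1)) n)
    (fun M => by
      rw [Finset.sum_sub_distrib, Finset.sum_comm]
      simp only [← Finset.mul_sum, sum_coef]
      exact hA M) hε.1 hε.2 (hs.congr_fun fun n => by
        rw [sub_mul, Finset.sum_mul]
        simp only [mul_assoc])
  have e : (∑ j ∈ Finset.range N, C (α j / j.factorial) * X ^ j : ℝ[X]).eval (negLog ε) =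
      ∑ j ∈ Finset.range N, α j * intTrunc (List.replicate j (1, 1)) ε := by
    rw [eval_finsetSum]
    refine Finset.sum_congr rfl fun j _ => ?_
    rw [intTrunc_replicate_one j hε.1 h1]
    simp only [eval_mul, eval_C, eval_pow, eval_X]
    ring
  rw [e, Real.norm_eq_abs, abs_mul, abs_of_nonneg (pow_nonneg hT k)]
  refine (mul_le_mul_of_nonneg_right hb (pow_nonneg hT k)).trans_eq ?_
  rw [← negLog]
  ring

lemma hasReg_zetaTrunc_of_expansion {l : List (ℕ × ℤˣ)} {N : ℕ} {α : ℕ → ℝ}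
    (h : Small fun M => zetaTrunc l M - ∑ j ∈ Finset.range N, α j * elemSum j M)
    {P : ℕ → ℝ[X]} (hP : ∀ j, HasReg atTop logGamma (elemSum j) (P j)) :
    HasReg atTop logGamma (zetaTrunc l) (∑ j ∈ Finset.range N, C (α j) * P j) := by
  have := h.negl.hasReg_zero.add
    (HasReg.sum (Finset.range N) fun j _ => (hP j).const_mul (α j))
  rw [zero_add] at this
  exact this.congr fun M => by ring

lemma exists_hasReg_zetaTrunc (l : List (ℕ × ℤˣ)) (hl : ∀ p ∈ l, 1 ≤ p.1) :
    ∃ P, HasReg atTop logGamma (zetaTrunc l) P := by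
  obtain ⟨N, α, h, -⟩ := exists_elemSum_expansion l hl
  choose P hP using exists_hasReg_elemSum
  exact ⟨_, hasReg_zetaTrunc_of_expansion h hP⟩

lemma exists_hasReg_intTrunc (l : List (ℕ × ℤˣ)) (hl : ∀ p ∈ l, 1 ≤ p.1) :
    ∃ P, HasReg (𝓝[>] 0) negLog (intTrunc l) P := by
  obtain ⟨N, α, h, -⟩ := exists_elemSum_expansion l hl
  exact ⟨_, hasReg_intTrunc_of_expansion hl h⟩

lemma existsUnique_isStuffleReg (l : List (ℕ × ℤˣ)) (hl : ∀ p ∈ l, 1 ≤ p.1) :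
    ∃! P, IsStuffleReg l P := by
  obtain ⟨P, hP⟩ := exists_hasReg_zetaTrunc l hl
  exact ⟨P, hP.tendsto, fun Q hQ => eq_of_tendsto_sub_eval tendsto_logGamma hQ hP.tendsto⟩

lemma existsUnique_isShuffleReg (l : List (ℕ × ℤˣ)) (hl : ∀ p ∈ l, 1 ≤ p.1) :
    ∃! P, IsShuffleReg l P := by
  obtain ⟨P, hP⟩ := exists_hasReg_intTrunc l hl
  exact ⟨P, hP.tendsto, fun Q hQ => eq_of_tendsto_sub_eval tendsto_negLog hQ hP.tendsto⟩

/-- The chosen polynomial is specified only up to `o(1)`; uniqueness identifies it with one whose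
error decays fast enough for products. -/
lemma hasReg_zetaSt (l : List (ℕ × ℤˣ)) (hl : ∀ p ∈ l, 1 ≤ p.1) :
    HasReg atTop logGamma (zetaTrunc l) (zetaSt l) := by
  obtain ⟨P, hP⟩ := exists_hasReg_zetaTrunc l hl
  have hex : ∃ P, IsStuffleReg l P := ⟨P, hP.tendsto⟩
  rw [zetaSt, dif_pos hex, eq_of_tendsto_sub_eval tendsto_logGamma hex.choose_spec hP.tendsto]
  exact hP

lemma hasReg_zetaSh (l : List (ℕ × ℤˣ)) (hl : ∀ p ∈ l, 1 ≤ p.1) :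
    HasReg (𝓝[>] 0) negLog (intTrunc l) (zetaSh l) := by
  obtain ⟨P, hP⟩ := exists_hasReg_intTrunc l hl
  have hex : ∃ P, IsShuffleReg l P := ⟨P, hP.tendsto⟩
  rw [zetaSh, dif_pos hex, eq_of_tendsto_sub_eval tendsto_negLog hex.choose_spec hP.tendsto]
  exact hP

/-- The two regularizations agree when they have degree at most one in `T`. -/
lemma zetaSh_eq_zetaSt {l : List (ℕ × ℤˣ)} (hl : ∀ p ∈ l, 1 ≤ p.1) (h : ¬ LeadingOnes l) :
    zetaSh l = zetaSt l := by
  obtain ⟨N, α, hα, -, hN⟩ := exists_elemSum_expansion l hl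
  choose P hP using exists_hasReg_elemSum
  rw [(hasReg_zetaSh l hl).unique tendsto_negLog (hasReg_intTrunc_of_expansion hl hα),
    (hasReg_zetaSt l hl).unique tendsto_logGamma (hasReg_zetaTrunc_of_expansion hα hP)]
  refine Finset.sum_congr rfl fun j hj => ?_
  -- Only `e_0 = 1` and `e_1 = H` occur; they regularize to `1` and `T`, matching `T^j / j!`.
  have hP0 : P 0 = 1 := (hP 0).unique tendsto_logGamma
    ((hasReg_const 1).congr fun M => (elemSum_zero M).symm)
  have hP1 : P 1 = X := (hP 1).unique tendsto_logGamma
    (hasReg_harm.congr fun M => (elemSum_one M).symm)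
  have hj2 : j < 2 := (Finset.mem_range.1 hj).trans_le (hN h)
  interval_cases j
  · simp [hP0]
  · simp [hP1]

end

end EulerSum

namespace EulerSum

noncomputable section

open Filter Topology

/-! ### Generating functions and the stuffle product -/

lemma mem_comps {d w : ℕ} {s : Fin d → ℕ} : s ∈ comps d w ↔ ∑ i, s i = w ∧ ∀ i, 1 ≤ s i := by
  simp [comps, Finset.Nat.mem_antidiagonalTuple]

lemma sum_comps_zero {A : Type*} [AddCommMonoid A] (w : ℕ) (F : (Fin 0 → ℕ) → A) :
    ∑ s ∈ comps 0 w, F s = if w = 0 then F ![] else 0 := by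
  split_ifs with h
  · have : comps 0 w = {![]} := by
      ext s
      simp [mem_comps, h, Subsingleton.elim s ![]]
    rw [this, Finset.sum_singleton]
  · have : comps 0 w = ∅ := by
      ext s
      simp [mem_comps, Ne.symm h]
    rw [this, Finset.sum_empty]

lemma sum_comps_succ {A : Type*} [AddCommMonoid A] (d w : ℕ) (F : (Fin (d + 1) → ℕ) → A) :
    ∑ s ∈ comps (d + 1) w, F s = ∑ m ∈ Finset.HasAntidiagonal.antidiagonal w,
      if m.1 = 0 then 0 else ∑ t ∈ comps d m.2, F (Fin.cons m.1 t) := by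
  have e : ∀ m : ℕ × ℕ, (if m.1 = 0 then 0 else ∑ t ∈ comps d m.2, F (Fin.cons m.1 t)) =
      ∑ t ∈ if m.1 = 0 then ∅ else comps d m.2, F (Fin.cons m.1 t) := fun m => by
    split_ifs <;> simp
  simp only [e]
  rw [Finset.sum_sigma']
  symm
  refine Finset.sum_bij' (fun p _ => Fin.cons p.1.1 p.2)
    (fun s _ => ⟨(s 0, ∑ i : Fin d, s i.succ), fun i => s i.succ⟩) ?_ ?_ ?_ ?_ ?_
  · rintro ⟨⟨a, b⟩, t⟩ h
    simp only [Finset.mem_sigma] at h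
    obtain ⟨h1, h2⟩ := h
    split_ifs at h2 with h3
    · simp at h2
    · rw [mem_comps] at h2 ⊢
      refine ⟨by simpa [Fin.sum_univ_succ, h2.1] using Finset.HasAntidiagonal.mem_antidiagonal.1 h1, fun i => ?_⟩
      refine Fin.cases ?_ (fun i => ?_) i
      · simp only [Fin.cons_zero]
        omega
      · simpa using h2.2 i
  · intro s h
    rw [mem_comps, Fin.sum_univ_succ] at h
    have h0 := h.2 0
    rw [Finset.mem_sigma, if_neg (by simp only; omega)]
    exact ⟨by simpa using h.1, mem_comps.2 ⟨rfl, fun i => h.2 i.succ⟩⟩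
  · rintro ⟨⟨a, b⟩, t⟩ h
    simp only [Finset.mem_sigma] at h
    obtain ⟨h1, h2⟩ := h
    split_ifs at h2 with h3
    · simp at h2
    · rw [mem_comps] at h2
      obtain rfl : ∑ i, t i = b := h2.1
      simp
  · intro s h
    exact Fin.cons_self_tail s
  · intros
    rfl

/-- Nested sums of sequences in a ring; the sequences are indexed from `0`. -/
def nest {R : Type*} [CommRing R] : List (ℕ → R) → ℕ → R
  | [], _ => 1
  | f :: l, M => ∑ n ∈ Finset.range M, f n * nest l n

/-- The three sums collect the pairs of outermost indices in which the first is larger, the second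
is larger, or both coincide. -/
lemma nest_mul_nest {R : Type*} [CommRing R] (f g : ℕ → R) (as bs : List (ℕ → R)) (M : ℕ) :
    nest (f :: as) M * nest (g :: bs) M =
      ∑ n ∈ Finset.range M, f n * (nest as n * nest (g :: bs) n) +
      ∑ n ∈ Finset.range M, g n * (nest (f :: as) n * nest bs n) +
      ∑ n ∈ Finset.range M, (f n * g n) * (nest as n * nest bs n) := by
  induction M with
  | zero => simp [nest]
  | succ M ih =>
    have h1 : ∀ (f : ℕ → R) l, nest (f :: l) (M + 1) = nest (f :: l) M + f M * nest l M :=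
      fun f l => Finset.sum_range_succ _ _
    rw [Finset.sum_range_succ, Finset.sum_range_succ, Finset.sum_range_succ, h1, h1]
    linear_combination ih

/-- The generating function `∑_s φ(s) μ^{n+1} / (n+1)^s u^s` over `s ≥ 1`. -/
def gen (φ : ℕ → ℝ) (μ : ℤˣ) (n : ℕ) : PowerSeries ℝ :=
  PowerSeries.mk fun s => if s = 0 then 0 else φ s * (((μ : ℤ) : ℝ) ^ (n + 1) / ((n : ℝ) + 1) ^ s)

lemma pairs_cons {d : ℕ} {α β : Type} (a : α) (s : Fin d → α) (m : Fin (d + 1) → β) :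
    pairs (Fin.cons a s : Fin (d + 1) → α) m = (a, m 0) :: pairs s fun i => m i.succ := by
  simp [pairs, List.ofFn_succ]

lemma coeff_nest_gen (d w M : ℕ) (φ : Fin d → ℕ → ℝ) (m : Fin d → ℤˣ) :
    PowerSeries.coeff w (nest (List.ofFn fun i => gen (φ i) (m i)) M) =
      ∑ s ∈ comps d w, (∏ i, φ i (s i)) * zetaTrunc (pairs s m) M := by
  induction d generalizing w M with
  | zero =>
    rw [sum_comps_zero]
    simp [nest, PowerSeries.coeff_one, pairs, zetaTrunc]
  | succ d ih =>
    rw [sum_comps_succ, List.ofFn_succ, nest, map_sum]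
    simp only [PowerSeries.coeff_mul, ih]
    rw [Finset.sum_comm]
    refine Finset.sum_congr rfl fun p _ => ?_
    simp only [gen, PowerSeries.coeff_mk]
    split_ifs with h
    · simp
    · simp only [pairs_cons, zetaTrunc_cons, Fin.prod_univ_succ, Fin.cons_zero, Fin.cons_succ,
        Finset.mul_sum]
      rw [Finset.sum_comm]
      exact Finset.sum_congr rfl fun t _ => Finset.sum_congr rfl fun n _ => by ring

/-- At a common summation index the exponents add, so the Cauchy product in the weight variable is
the convolution `x ⊗ y`. -/
lemma gen_conv (x y : ℝ) (μ ν : ℤˣ) (n : ℕ) :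
    gen (StVar.conv x y).pow (μ * ν) n =
      gen (fun s => x ^ (s - 1)) μ n * gen (fun s => y ^ (s - 1)) ν n := by
  ext s
  rw [PowerSeries.coeff_mul]
  simp only [gen, PowerSeries.coeff_mk]
  rw [Finset.Nat.sum_antidiagonal_eq_sum_range_succ (fun a b =>
    (if a = 0 then 0 else x ^ (a - 1) * (((μ : ℤ) : ℝ) ^ (n + 1) / ((n : ℝ) + 1) ^ a)) *
    (if b = 0 then 0 else y ^ (b - 1) * (((ν : ℤ) : ℝ) ^ (n + 1) / ((n : ℝ) + 1) ^ b)))]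
  have hsub : Finset.Icc 1 (s - 1) ⊆ Finset.range s.succ := fun a ha => by
    simp only [Finset.mem_Icc, Finset.mem_range] at ha ⊢
    omega
  rw [← Finset.sum_subset hsub fun a ha ha' => ?_]
  · split_ifs with h
    · simp [h]
    · rw [StVar.pow, Finset.sum_mul]
      refine Finset.sum_congr rfl fun a ha => ?_
      rw [Finset.mem_Icc] at ha
      rw [if_neg (by omega), if_neg (by omega)]
      have e : ((n : ℝ) + 1) ^ s = ((n : ℝ) + 1) ^ a * ((n : ℝ) + 1) ^ (s - a) := by
        rw [← pow_add]
        congr 1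
        omega
      rw [e]
      push_cast
      rw [mul_pow, mul_div_mul_comm]
      ring
  · simp only [Finset.mem_Icc, Finset.mem_range] at ha ha'
    rcases Nat.eq_zero_or_pos a with h | h
    · simp [h]
    · rw [if_pos (by omega : s - a = 0), mul_zero]

/-- The sequence attached to a variable with sign. -/
def genVar (p : ℝ × ℤˣ) : ℕ → PowerSeries ℝ := gen (fun s => p.1 ^ (s - 1)) p.2

/-- The sequence attached to an entry of a stuffle. -/
def genStVar (p : StVar × ℤˣ) : ℕ → PowerSeries ℝ := gen p.1.pow p.2

lemma nest_sum_cons {R ι : Type*} [CommRing R] (L : List ι) (f : ℕ → R)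
    (g : ι → List (ℕ → R)) (M : ℕ) :
    (L.map fun z => nest (f :: g z) M).sum =
      ∑ n ∈ Finset.range M, f n * (L.map fun z => nest (g z) n).sum := by
  induction L with
  | nil => simp
  | cons z L ih =>
    simp only [List.map_cons, List.sum_cons, mul_add, Finset.sum_add_distrib]
    rw [ih, nest]

/-- The recursion for `stuffles` and the three-way splitting `nest_mul_nest` have the same shape;
merged entries come from equal indices via `gen_conv`. -/
theorem nest_mul_eq_sum_stuffles (xs ys : List (ℝ × ℤˣ)) (M : ℕ) :
    nest (xs.map genVar) M * nest (ys.map genVar) M =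
      ((stuffles xs ys).map fun z => nest (z.map genStVar) M).sum := by
  have hsingle : ∀ l : List (ℝ × ℤˣ),
      (l.map fun b => (StVar.single b.1, b.2)).map genStVar = l.map genVar := fun l => by
    rw [List.map_map]
    rfl
  induction xs, ys using stuffles.induct generalizing M with
  | case1 bs => simp [stuffles, nest, hsingle, -List.map_map]
  | case2 a as =>
    rw [stuffles, List.map_singleton, List.sum_singleton, hsingle]
    simp [nest]
  | case3 a as b bs ih1 ih2 ih3 =>
    have hconv : genStVar (StVar.conv a.1 b.1, a.2 * b.2) = fun n => genVar a n * genVar b n :=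
      funext fun n => gen_conv a.1 b.1 a.2 b.2 n
    simp only [stuffles, List.map_append, List.sum_append, List.map_map, Function.comp_def,
      List.map_cons, nest_sum_cons, ← ih1, ← ih2, ← ih3, nest_mul_nest, hconv]
    rfl

lemma ofFn_get_map {α β : Type*} (f : α → β) (l : List α) :
    (List.ofFn fun i => f (l.get i)) = l.map f := by
  rw [← Function.comp_def, ← List.map_ofFn, List.ofFn_get]

lemma zip_ofFn {α β : Type} (l : List β) {n : ℕ} (h : n = l.length) (s : Fin n → α) :
    (List.ofFn s).zip l = pairs s fun i => l.get (i.cast h) := by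
  subst h
  refine List.ext_getElem (by simp [pairs]) fun i h1 h2 => ?_
  simp [pairs]

lemma one_le_of_mem_pairs {d w : ℕ} {s : Fin d → ℕ} (hs : s ∈ comps d w) (m : Fin d → ℤˣ) :
    ∀ p ∈ pairs s m, 1 ≤ p.1 := by
  intro p hp
  obtain ⟨i, rfl⟩ := (List.mem_ofFn' _ _).1 hp
  exact (mem_comps.1 hs).2 i

lemma hasReg_genSt (w : ℕ) (z : List (StVar × ℤˣ)) :
    HasReg atTop logGamma (fun M => PowerSeries.coeff w (nest (z.map genStVar) M)) (genSt w z) := by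
  have e : (List.ofFn fun i : Fin z.length => gen (z.get i).1.pow (z.get i).2) =
      z.map genStVar := ofFn_get_map genStVar z
  have e2 : ∀ s : Fin z.length → ℕ, (List.ofFn s).zip (z.map Prod.snd) =
      pairs s fun i => (z.get i).2 := fun s => by
    rw [zip_ofFn _ (by simp)]
    simp
  simp only [← e, coeff_nest_gen, genSt, e2]
  exact HasReg.sum _ fun s hs => (hasReg_zetaSt _ (one_le_of_mem_pairs hs _)).const_mul _

lemma map_genVar_pairs {d : ℕ} (x : Fin d → ℝ) (μ : Fin d → ℤˣ) :
    (pairs x μ).map genVar = List.ofFn fun i => gen (fun s => x i ^ (s - 1)) (μ i) := by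
  rw [pairs, List.map_ofFn]
  rfl

/-- The stuffle product formula for regularized generating functions. -/
theorem stuffleSide_eq (w : ℕ) {d d' : ℕ} (x : Fin d → ℝ) (μ : Fin d → ℤˣ) (y : Fin d' → ℝ)
    (ν : Fin d' → ℤˣ) :
    stuffleSide w (pairs x μ) (pairs y ν) =
      ∑ m ∈ Finset.HasAntidiagonal.antidiagonal w, ∑ s ∈ comps d m.1, ∑ t ∈ comps d' m.2,
        Polynomial.C ((∏ i, x i ^ (s i - 1)) * ∏ j, y j ^ (t j - 1)) *
          (zetaSt (pairs s μ) * zetaSt (pairs t ν)) := by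
  refine (HasReg.list_sum _ fun z _ => hasReg_genSt w z).unique tendsto_logGamma ?_
  refine (HasReg.sum _ fun m _ => HasReg.sum _ fun s hs => HasReg.sum _ fun t ht =>
    ((hasReg_zetaSt _ (one_le_of_mem_pairs hs μ)).mul
      (hasReg_zetaSt _ (one_le_of_mem_pairs ht ν))).const_mul _).congr fun M => ?_
  have e : ∀ L : List (List (StVar × ℤˣ)),
      (L.map fun z => PowerSeries.coeff w (nest (z.map genStVar) M)).sum =
        PowerSeries.coeff w (L.map fun z => nest (z.map genStVar) M).sum := fun L => by
    rw [map_list_sum, List.map_map]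
    rfl
  rw [e, ← nest_mul_eq_sum_stuffles, map_genVar_pairs, map_genVar_pairs, PowerSeries.coeff_mul]
  refine Finset.sum_congr rfl fun m _ => ?_
  rw [coeff_nest_gen, coeff_nest_gen, Finset.sum_mul_sum]
  exact Finset.sum_congr rfl fun s _ => Finset.sum_congr rfl fun t _ => by ring

end

end EulerSum

namespace EulerSum

noncomputable section

open Filter Topology

/-! ### The shuffle product -/

/-- The Euler operator `X d/dX`. -/
def theta {R : Type*} [CommRing R] (F : PowerSeries R) : PowerSeries R :=
  PowerSeries.mk fun n => (n : R) * PowerSeries.coeff n F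

section Theta

variable {R : Type*} [CommRing R]

lemma coeff_theta (F : PowerSeries R) (n : ℕ) :
    PowerSeries.coeff n (theta F) = (n : R) * PowerSeries.coeff n F := PowerSeries.coeff_mk _ _

lemma theta_add (F G : PowerSeries R) : theta (F + G) = theta F + theta G := by
  ext n
  simp [coeff_theta, mul_add]

lemma theta_sub (F G : PowerSeries R) : theta (F - G) = theta F - theta G := by
  ext n
  simp [coeff_theta, mul_sub]

lemma theta_mul (F G : PowerSeries R) : theta (F * G) = theta F * G + F * theta G := by
  ext n
  rw [coeff_theta, map_add, PowerSeries.coeff_mul, PowerSeries.coeff_mul, PowerSeries.coeff_mul,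
    Finset.mul_sum, ← Finset.sum_add_distrib]
  refine Finset.sum_congr rfl fun p hp => ?_
  rw [coeff_theta, coeff_theta, ← Finset.HasAntidiagonal.mem_antidiagonal.1 hp]
  push_cast
  ring

end Theta

/-- `z u`, where `u` is the variable recording the weight. -/
def scaleU (z : ℝ) : PowerSeries ℝ := PowerSeries.C z * PowerSeries.X

lemma scaleU_add (x y : ℝ) : scaleU (x + y) = scaleU x + scaleU y := by
  simp [scaleU, add_mul]

/-- `theta F = z u F` has no nonzero solution without constant term. -/
lemma eq_zero_of_theta_eq {F : PowerSeries (PowerSeries ℝ)} {z : ℝ}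
    (h0 : PowerSeries.coeff 0 F = 0) (h : theta F = PowerSeries.C (scaleU z) * F) : F = 0 := by
  ext1 n
  rw [map_zero]
  rcases eq_or_ne n 0 with rfl | hn
  · exact h0
  · have e := congrArg (PowerSeries.coeff n) h
    rw [coeff_theta, PowerSeries.coeff_C_mul, ← sub_eq_zero, ← sub_mul] at e
    -- The factor `n - z u` has constant term `n ≠ 0`, hence is nonzero in the domain `ℝ⟦u⟧`.
    refine (mul_eq_zero.1 e).resolve_left fun h' => hn ?_
    have := congrArg PowerSeries.constantCoeff h'
    simpa [scaleU] using this

/-- `X / (m - X)`. -/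
def kern (m : ℤˣ) : PowerSeries (PowerSeries ℝ) :=
  PowerSeries.mk fun n => if n = 0 then 0 else PowerSeries.C (((m : ℤ) : ℝ) ^ n)

/-- The generating function of the iterated integrals attached to a string of variables. -/
def shGen : List (ℝ × ℤˣ) → PowerSeries (PowerSeries ℝ)
  | [] => 1
  | p :: l => PowerSeries.mk fun n => match n with
    | 0 => 0
    | n + 1 => genVar (p.1, 1) n * PowerSeries.coeff (n + 1) (kern p.2 * shGen l)

lemma coeff_zero_shGen_cons (p : ℝ × ℤˣ) (l : List (ℝ × ℤˣ)) :
    PowerSeries.coeff 0 (shGen (p :: l)) = 0 := by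
  simp [shGen]

lemma coeff_succ_shGen_cons (p : ℝ × ℤˣ) (l : List (ℝ × ℤˣ)) (n : ℕ) :
    PowerSeries.coeff (n + 1) (shGen (p :: l)) =
      genVar (p.1, 1) n * PowerSeries.coeff (n + 1) (kern p.2 * shGen l) := by
  rw [shGen, PowerSeries.coeff_mk]

/-- The geometric series `∑ z^{s-1} u^s / (n+1)^s` is `u / (n + 1 - z u)`, written without division.
-/
lemma genVar_one_eq (z : ℝ) (n : ℕ) :
    ((n : PowerSeries ℝ) + 1) * genVar (z, 1) n = scaleU z * genVar (z, 1) n + PowerSeries.X := by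
  have hn : (n : ℝ) + 1 ≠ 0 := by positivity
  have e : (n : PowerSeries ℝ) + 1 = PowerSeries.C ((n : ℝ) + 1) := by simp
  rw [e, scaleU, mul_assoc]
  ext s
  rw [map_add (PowerSeries.coeff s), PowerSeries.coeff_C_mul, PowerSeries.coeff_C_mul,
    PowerSeries.coeff_X]
  rcases s with _ | _ | s
  · simp [genVar, gen]
  · rw [PowerSeries.coeff_succ_X_mul]
    simp [genVar, gen, hn]
  · rw [PowerSeries.coeff_succ_X_mul]
    simp only [genVar, gen, PowerSeries.coeff_mk]
    simp
    field_simp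
    ring

/-- The differential equation packages all exponents at once: on the coefficient of `X^{n+1}`, `θ`
acts as `n + 1`, and `(n + 1 - z u)` clears the geometric series. -/
lemma theta_shGen_cons (p : ℝ × ℤˣ) (l : List (ℝ × ℤˣ)) :
    theta (shGen (p :: l)) = PowerSeries.C (scaleU p.1) * shGen (p :: l) +
      PowerSeries.C PowerSeries.X * (kern p.2 * shGen l) := by
  ext1 n
  rw [coeff_theta, map_add, PowerSeries.coeff_C_mul, PowerSeries.coeff_C_mul]
  rcases n with _ | n
  · rw [coeff_zero_shGen_cons]
    simp [kern, PowerSeries.coeff_mul]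
  · rw [coeff_succ_shGen_cons]
    push_cast
    linear_combination PowerSeries.coeff (n + 1) (kern p.2 * shGen l) * genVar_one_eq p.1 n

lemma clone_map_inl (l : List (ℝ × ℤˣ)) : clone (l.map Sum.inl) = l := by
  have h : ∀ l : List (ℝ × ℤˣ), firstRight (l.map Sum.inl) = 0 := fun l => by
    induction l with
    | nil => rfl
    | cons a l ih => simpa [firstRight] using ih
  induction l with
  | nil => rfl
  | cons a l ih => simp [clone, h, ih]

lemma clone_map_inr (l : List (ℝ × ℤˣ)) : clone (l.map Sum.inr) = l := by
  have h : ∀ l : List (ℝ × ℤˣ), firstLeft (l.map Sum.inr) = 0 := fun l => by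
    induction l with
    | nil => rfl
    | cons a l ih => simpa [firstLeft] using ih
  induction l with
  | nil => rfl
  | cons a l ih => simp [clone, h, ih]

/-- Interleaving preserves the order of each string, so the variable that `κ` adds is the same for
every interleaving. -/
lemma firstRight_of_mem_shuffles (as : List (ℝ × ℤˣ)) (b : ℝ × ℤˣ) (bs : List (ℝ × ℤˣ)) :
    ∀ z ∈ shuffles as (b :: bs), firstRight z = b.1 := by
  induction as with
  | nil => simp [shuffles, firstRight]
  | cons a as ih =>
    intro z hz
    simp only [shuffles, List.mem_append, List.mem_map] at hz
    rcases hz with ⟨z, hz, rfl⟩ | ⟨z, -, rfl⟩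
    · simpa [firstRight] using ih z hz
    · simp [firstRight]

lemma firstLeft_of_mem_shuffles (a : ℝ × ℤˣ) (as bs : List (ℝ × ℤˣ)) :
    ∀ z ∈ shuffles (a :: as) bs, firstLeft z = a.1 := by
  induction bs with
  | nil => simp [shuffles, firstLeft]
  | cons b bs ih =>
    intro z hz
    simp only [shuffles, List.mem_append, List.mem_map] at hz
    rcases hz with ⟨z, -, rfl⟩ | ⟨z, hz, rfl⟩
    · simp [firstLeft]
    · simpa [firstLeft] using ih z hz

/-- A family of strings with a common first entry. -/
lemma theta_sum_shGen_cons {ι : Type*} (p : ℝ × ℤˣ) (L : List ι) (f : ι → List (ℝ × ℤˣ)) :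
    theta (L.map fun z => shGen (p :: f z)).sum =
      PowerSeries.C (scaleU p.1) * (L.map fun z => shGen (p :: f z)).sum +
      PowerSeries.C PowerSeries.X * (kern p.2 * (L.map fun z => shGen (f z)).sum) := by
  induction L with
  | nil =>
    ext1 n
    simp [coeff_theta]
  | cons z L ih =>
    simp only [List.map_cons, List.sum_cons, theta_add, ih, theta_shGen_cons]
    ring

lemma coeff_zero_sum_shGen_cons {ι : Type*} (p : ℝ × ℤˣ) (L : List ι)
    (f : ι → List (ℝ × ℤˣ)) :
    PowerSeries.coeff 0 (L.map fun z => shGen (p :: f z)).sum = 0 := by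
  induction L with
  | nil => simp
  | cons z L ih => rw [List.map_cons, List.sum_cons, map_add, ih, coeff_zero_shGen_cons, add_zero]

/-- By the Leibniz rule and induction, both sides solve the same first-order equation with
coefficient `(x + y) u`, inhomogeneous terms included. The difference solves the homogeneous
equation without constant term, so it vanishes. -/
theorem shGen_mul_eq_sum_shuffles (xs ys : List (ℝ × ℤˣ)) :
    shGen xs * shGen ys = ((shuffles xs ys).map fun z => shGen (clone z)).sum := by
  induction xs, ys using shuffles.induct with
  | case1 bs => simp [shuffles, shGen, clone_map_inr]
  | case2 a as =>
    rw [shuffles, List.map_singleton, List.sum_singleton, clone_map_inl, shGen.eq_1, mul_one]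
  | case3 a as b bs ih1 ih2 =>
    have e1 : ((shuffles as (b :: bs)).map fun z => shGen (clone (Sum.inl a :: z))) =
        (shuffles as (b :: bs)).map fun z => shGen ((a.1 + b.1, a.2) :: clone z) :=
      List.map_congr_left fun z hz => by rw [clone, firstRight_of_mem_shuffles as b bs z hz]
    have e2 : ((shuffles (a :: as) bs).map fun z => shGen (clone (Sum.inr b :: z))) =
        (shuffles (a :: as) bs).map fun z => shGen ((a.1 + b.1, b.2) :: clone z) :=
      List.map_congr_left fun z hz => by
        rw [clone, firstLeft_of_mem_shuffles a as bs z hz, add_comm b.1]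
    simp only [shuffles, List.map_append, List.sum_append, List.map_map, Function.comp_def]
    rw [e1, e2, ← sub_eq_zero]
    refine eq_zero_of_theta_eq (z := a.1 + b.1) ?_ ?_
    · rw [map_sub, map_add, coeff_zero_sum_shGen_cons, coeff_zero_sum_shGen_cons]
      simp [PowerSeries.coeff_mul, coeff_zero_shGen_cons]
    · rw [theta_sub, theta_add, theta_mul, theta_sum_shGen_cons, theta_sum_shGen_cons, ← ih1, ← ih2,
        theta_shGen_cons, theta_shGen_cons]
      simp only [scaleU_add, map_add]
      ring

/-! ### From shuffle series back to Euler sums -/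

/-- The sequences attached to the index string `q(ξ)`, with initial sign `c`. -/
def shSeqs (c : ℤˣ) : List (ℝ × ℤˣ) → List (ℕ → PowerSeries ℝ)
  | [] => []
  | p :: l => genVar (p.1, p.2 * c) :: shSeqs p.2 l

/-- The part of a nested sum in which the outermost variable is maximal. -/
def nestTop {R : Type*} [CommRing R] (l : List (ℕ → R)) : ℕ → R
  | 0 => nest l 0
  | n + 1 => nest l (n + 1) - nest l n

lemma sum_nestTop {R : Type*} [CommRing R] (l : List (ℕ → R)) (M : ℕ) :
    ∑ n ∈ Finset.range (M + 1), nestTop l n = nest l M := by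
  rw [Finset.sum_range_succ']
  simp only [nestTop]
  rw [Finset.sum_range_sub, sub_add_cancel]

lemma genVar_eq_sign_mul (z : ℝ) (μ : ℤˣ) (n : ℕ) :
    genVar (z, μ) n = PowerSeries.C (((μ : ℤ) : ℝ) ^ (n + 1)) * genVar (z, 1) n := by
  ext s
  rw [PowerSeries.coeff_C_mul]
  simp only [genVar, gen, PowerSeries.coeff_mk]
  split_ifs
  · simp
  · simp
    ring

/-- Multiplication by `X/(m - X)` forms `m`-twisted sums over strictly smaller indices, because the
kernel has no constant term. Pulling out the preceding sign `c` changes `m` to `m c`, as in `q`; `c`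
is arbitrary so that the induction can move it along the string. -/
lemma coeff_shGen_eq_sign_mul (l : List (ℝ × ℤˣ)) (c : ℤˣ) (n : ℕ) :
    PowerSeries.coeff n (shGen l) =
      PowerSeries.C (((c : ℤ) : ℝ) ^ n) * nestTop (shSeqs c l) n := by
  induction l generalizing c n with
  | nil =>
    rcases n with _ | n
    · simp [shGen, shSeqs, nestTop, nest]
    · simp [shGen, shSeqs, nestTop, nest, PowerSeries.coeff_one]
  | cons p l ih =>
    rcases n with _ | n
    · rw [coeff_zero_shGen_cons]
      simp [shSeqs, nestTop, nest]
    · have h1 : PowerSeries.coeff (n + 1) (kern p.2 * shGen l) =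
          PowerSeries.C (((p.2 : ℤ) : ℝ) ^ (n + 1)) * nest (shSeqs p.2 l) n := by
        rw [mul_comm, PowerSeries.coeff_mul, Finset.Nat.sum_antidiagonal_eq_sum_range_succ
          (fun i j => PowerSeries.coeff i (shGen l) * PowerSeries.coeff j (kern p.2)),
          Finset.sum_range_succ, ← sum_nestTop, Finset.mul_sum]
        simp only [kern, PowerSeries.coeff_mk, Nat.sub_self, if_true, mul_zero, add_zero]
        refine Finset.sum_congr rfl fun i hi => ?_
        have hi : i ≤ n := Nat.lt_succ_iff.1 (Finset.mem_range.1 hi)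
        rw [if_neg (by omega), ih p.2, mul_right_comm, ← map_mul, ← pow_add,
          Nat.add_sub_cancel' (by omega)]
      have h2 : nestTop (shSeqs c (p :: l)) (n + 1) =
          genVar (p.1, p.2 * c) n * nest (shSeqs p.2 l) n := by
        rw [nestTop, shSeqs, nest, nest, Finset.sum_range_succ, add_sub_cancel_left]
      rw [h2, genVar_eq_sign_mul, coeff_succ_shGen_cons, h1]
      have h3 : (PowerSeries.C (((c : ℤ) : ℝ) ^ (n + 1)) *
          PowerSeries.C ((((p.2 * c : ℤˣ) : ℤ) : ℝ) ^ (n + 1)) : PowerSeries ℝ) =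
          PowerSeries.C (((p.2 : ℤ) : ℝ) ^ (n + 1)) := by
        rw [← map_mul, ← mul_pow]
        congr 2
        push_cast
        rw [mul_left_comm, sign_mul_self, mul_one]
      rw [← h3]
      ring

lemma coeff_shGen (l : List (ℝ × ℤˣ)) (n : ℕ) :
    PowerSeries.coeff n (shGen l) = nestTop (shSeqs 1 l) n := by
  simpa using coeff_shGen_eq_sign_mul l 1 n

lemma coeff_nestTop_gen (d w n : ℕ) (φ : Fin d → ℕ → ℝ) (m : Fin d → ℤˣ) :
    PowerSeries.coeff w (nestTop (List.ofFn fun i => gen (φ i) (m i)) n) =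
      ∑ s ∈ comps d w, (∏ i, φ i (s i)) * coef (pairs s m) n := by
  rcases n with _ | n
  · rw [nestTop, coeff_nest_gen]
    simp only [coef_zero]
  · rw [nestTop, map_sub, coeff_nest_gen, coeff_nest_gen, ← Finset.sum_sub_distrib]
    simp only [coef_succ, mul_sub]

lemma length_qAux (c : ℤˣ) (l : List ℤˣ) : (qAux c l).length = l.length := by
  induction l generalizing c with
  | nil => rfl
  | cons m l ih => simp [qAux, ih]

lemma shSeqs_eq_zipWith (c : ℤˣ) (l : List (ℝ × ℤˣ)) :
    shSeqs c l = List.zipWith (fun p m => genVar (p.1, m)) l (qAux c (l.map Prod.snd)) := by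
  induction l generalizing c with
  | nil => rfl
  | cons p l ih => simp [shSeqs, qAux, ih]

lemma length_qSign_map (l : List (ℝ × ℤˣ)) : l.length = (qSign (l.map Prod.snd)).length := by
  simp [qSign, length_qAux]

lemma shSeqs_one_eq (l : List (ℝ × ℤˣ)) :
    shSeqs 1 l = List.ofFn fun i : Fin l.length => gen (fun s => (l.get i).1 ^ (s - 1))
      ((qSign (l.map Prod.snd)).get (i.cast (length_qSign_map l))) := by
  have h := length_qSign_map l
  rw [shSeqs_eq_zipWith]
  change List.zipWith (fun p m => genVar (p.1, m)) l (qSign (l.map Prod.snd)) = _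
  refine List.ext_getElem (by simp [← h]) fun i h1 h2 => ?_
  simp [genVar]

/-- Ratios of consecutive partial products return the original signs, a sign being its own inverse.
-/
lemma qAux_prod {d : ℕ} (c : ℤˣ) (μ : Fin d → ℤˣ) :
    qAux c (List.ofFn fun i => c * pSign μ i) = List.ofFn μ := by
  induction d generalizing c with
  | zero => simp [qAux]
  | succ d ih =>
    have h0 : pSign μ 0 = μ 0 := by
      have : Finset.Iic (0 : Fin (d + 1)) = {0} := by
        ext i
        simp
      simp [pSign, this]
    have hs : ∀ i : Fin d, pSign μ i.succ = μ 0 * pSign (fun j => μ j.succ) i := by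
      intro i
      have e : ∀ {n : ℕ} (i : Fin n), Finset.Iic i = Finset.univ.filter (· ≤ i) := fun i => by
        ext j
        simp
      simp only [pSign, e, Finset.prod_filter, Fin.prod_univ_succ, Fin.succ_le_succ_iff,
        Fin.zero_le, if_true]
    rw [List.ofFn_succ, List.ofFn_succ, qAux, h0]
    simp only [hs, ← mul_assoc]
    rw [ih, mul_right_comm, Int.units_mul_self, one_mul]

lemma qSign_pSign {d : ℕ} (μ : Fin d → ℤˣ) : qSign (List.ofFn (pSign μ)) = List.ofFn μ := by
  simpa [qSign] using qAux_prod 1 μ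

lemma shSeqs_pairs {d : ℕ} (x : Fin d → ℝ) (μ : Fin d → ℤˣ) :
    shSeqs 1 (pairs x (pSign μ)) = List.ofFn fun i => gen (fun s => x i ^ (s - 1)) (μ i) := by
  have h : (pairs x (pSign μ)).map Prod.snd = List.ofFn (pSign μ) := by
    rw [pairs, List.map_ofFn]
    rfl
  rw [shSeqs_eq_zipWith, h]
  change List.zipWith _ _ (qSign _) = _
  rw [qSign_pSign, pairs]
  refine List.ext_getElem (by simp) fun i h1 h2 => ?_
  simp [genVar]

/-! ### Specialization at `1 - ε` and regularization of the shuffle product -/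

/-- The real function whose regularization is `genSh w z`. -/
def genInt (w : ℕ) (z : List (ℝ × ℤˣ)) (ε : ℝ) : ℝ :=
  ∑ s ∈ comps z.length w, (∏ i, (z.get i).1 ^ (s i - 1)) *
    intTrunc ((List.ofFn s).zip (qSign (z.map Prod.snd))) ε

lemma hasReg_genSh (w : ℕ) (z : List (ℝ × ℤˣ)) :
    HasReg (𝓝[>] 0) negLog (genInt w z) (genSh w z) := by
  refine HasReg.sum _ fun s hs => (hasReg_zetaSh _ ?_).const_mul _
  rw [zip_ofFn _ (length_qSign_map z)]
  exact one_le_of_mem_pairs hs _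

lemma hasSum_genInt (w : ℕ) (z : List (ℝ × ℤˣ)) {ε : ℝ} (h0 : 0 < ε) (h1 : ε ≤ 1) :
    HasSum (fun n => PowerSeries.coeff w (PowerSeries.coeff n (shGen z)) * (1 - ε) ^ n)
      (genInt w z ε) := by
  have h := hasSum_sum (s := comps z.length w) fun s hs =>
    (hasSum_intTrunc _ (one_le_of_mem_pairs hs fun i =>
      (qSign (z.map Prod.snd)).get (i.cast (length_qSign_map z))) h0 h1).mul_left
      (∏ i, (z.get i).1 ^ (s i - 1))
  simp only [genInt, zip_ofFn _ (length_qSign_map z)]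
  refine h.congr_fun fun n => ?_
  rw [coeff_shGen, shSeqs_one_eq, coeff_nestTop_gen, Finset.sum_mul]
  simp only [mul_assoc]

/-- Inside the unit disc the series converge absolutely, so their Cauchy product may be used. -/
lemma hasSum_intTrunc_mul {k l : List (ℕ × ℤˣ)} (hk : ∀ p ∈ k, 1 ≤ p.1) (hl : ∀ p ∈ l, 1 ≤ p.1)
    {ε : ℝ} (h0 : 0 < ε) (h1 : ε ≤ 1) :
    HasSum (fun n => (∑ p ∈ Finset.HasAntidiagonal.antidiagonal n, coef k p.1 * coef l p.2) *
      (1 - ε) ^ n) (intTrunc k ε * intTrunc l ε) := by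
  have h2 : 0 ≤ 1 - ε := by linarith
  have h3 : 1 - ε < 1 := by linarith
  have hs : ∀ l : List (ℕ × ℤˣ), (∀ p ∈ l, 1 ≤ p.1) →
      Summable fun n => ‖coef l n * (1 - ε) ^ n‖ := fun l hl =>
    (summable_coef_pow l hl h2 h3).congr fun n => by
      rw [Real.norm_eq_abs, abs_mul, abs_of_nonneg (pow_nonneg h2 n)]
  rw [← (hasSum_intTrunc k hk h0 h1).tsum_eq, ← (hasSum_intTrunc l hl h0 h1).tsum_eq,
    tsum_mul_tsum_eq_tsum_sum_antidiagonal_of_summable_norm (hs k hk) (hs l hl)]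
  refine (summable_norm_sum_mul_antidiagonal_of_summable_norm (hs k hk) (hs l hl)).of_norm.hasSum
    |>.congr_fun fun n => ?_
  rw [Finset.sum_mul]
  refine Finset.sum_congr rfl fun p hp => ?_
  rw [← Finset.HasAntidiagonal.mem_antidiagonal.1 hp, pow_add]
  ring

lemma hasSum_list_sum {ι : Type*} (L : List ι) {f : ι → ℕ → ℝ} {y : ι → ℝ}
    (h : ∀ i, HasSum (f i) (y i)) : HasSum (fun n => (L.map fun i => f i n).sum) (L.map y).sum := by
  induction L with
  | nil => simp
  | cons i L ih => simpa using (h i).add ih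

/-- The shuffle product formula for the truncated iterated integrals. -/
lemma sum_genInt_shuffles (w : ℕ) {d d' : ℕ} (x : Fin d → ℝ) (μ : Fin d → ℤˣ) (y : Fin d' → ℝ)
    (ν : Fin d' → ℤˣ) {ε : ℝ} (h0 : 0 < ε) (h1 : ε ≤ 1) :
    ((shuffles (pairs x (pSign μ)) (pairs y (pSign ν))).map fun z => genInt w (clone z) ε).sum =
      ∑ m ∈ Finset.HasAntidiagonal.antidiagonal w, ∑ s ∈ comps d m.1, ∑ t ∈ comps d' m.2,
        ((∏ i, x i ^ (s i - 1)) * ∏ j, y j ^ (t j - 1)) *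
          (intTrunc (pairs s μ) ε * intTrunc (pairs t ν) ε) := by
  refine (hasSum_list_sum _ fun z => hasSum_genInt w (clone z) h0 h1).unique ?_
  refine (hasSum_sum fun m _ => hasSum_sum fun s hs => hasSum_sum fun t ht =>
    (hasSum_intTrunc_mul (one_le_of_mem_pairs hs μ) (one_le_of_mem_pairs ht ν) h0 h1).mul_left
      _).congr_fun fun n => ?_
  have e : ∀ L : List (List ((ℝ × ℤˣ) ⊕ (ℝ × ℤˣ))), (L.map fun z =>
      PowerSeries.coeff w (PowerSeries.coeff n (shGen (clone z))) * (1 - ε) ^ n).sum =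
        PowerSeries.coeff w (PowerSeries.coeff n (L.map fun z => shGen (clone z)).sum) *
          (1 - ε) ^ n := fun L => by
    induction L with
    | nil => simp
    | cons z L ih => simp only [List.map_cons, List.sum_cons, map_add, add_mul, ih]
  rw [e, ← shGen_mul_eq_sum_shuffles, PowerSeries.coeff_mul, map_sum]
  simp only [PowerSeries.coeff_mul, coeff_shGen, shSeqs_pairs, coeff_nestTop_gen]
  rw [Finset.sum_comm, Finset.sum_mul]
  refine Finset.sum_congr rfl fun m _ => ?_
  simp only [Finset.sum_mul_sum]
  rw [Finset.sum_comm, Finset.sum_mul]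
  refine Finset.sum_congr rfl fun s _ => ?_
  rw [Finset.sum_comm, Finset.sum_mul]
  refine Finset.sum_congr rfl fun t _ => ?_
  rw [← mul_assoc, Finset.mul_sum]
  congr 1
  exact Finset.sum_congr rfl fun p _ => by ring

/-- The shuffle product formula for regularized generating functions. -/
theorem shuffleSide_eq (w : ℕ) {d d' : ℕ} (x : Fin d → ℝ) (μ : Fin d → ℤˣ) (y : Fin d' → ℝ)
    (ν : Fin d' → ℤˣ) :
    shuffleSide w (pairs x (pSign μ)) (pairs y (pSign ν)) =
      ∑ m ∈ Finset.HasAntidiagonal.antidiagonal w, ∑ s ∈ comps d m.1, ∑ t ∈ comps d' m.2,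
        Polynomial.C ((∏ i, x i ^ (s i - 1)) * ∏ j, y j ^ (t j - 1)) *
          (zetaSh (pairs s μ) * zetaSh (pairs t ν)) := by
  have h1 := HasReg.list_sum (shuffles (pairs x (pSign μ)) (pairs y (pSign ν)))
    fun z _ => hasReg_genSh w (clone z)
  have h2 := HasReg.sum (Finset.HasAntidiagonal.antidiagonal w) fun m _ =>
    HasReg.sum (comps d m.1) fun s hs => HasReg.sum (comps d' m.2) fun t ht =>
      ((hasReg_zetaSh _ (one_le_of_mem_pairs hs μ)).mul
        (hasReg_zetaSh _ (one_le_of_mem_pairs ht ν))).const_mul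
          ((∏ i, x i ^ (s i - 1)) * ∏ j, y j ^ (t j - 1))
  refine eq_of_tendsto_sub_eval tendsto_negLog h1.tendsto (h2.tendsto.congr' ?_)
  filter_upwards [Ioc_mem_nhdsGT one_pos] with ε hε
  rw [sum_genInt_shuffles w x μ y ν hε.1 hε.2]

/-- Either `δ = 1` and both sides vanish, or neither index has two leading entries `(1, 1)` and the
regularizations coincide. -/
lemma delta_mul_eq {k l : List (ℕ × ℤˣ)} (hk : ∀ p ∈ k, 1 ≤ p.1) (hl : ∀ p ∈ l, 1 ≤ p.1) :
    (1 - delta k l) * (zetaSh k * zetaSh l) = (1 - delta k l) * (zetaSt k * zetaSt l) := by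
  rw [delta]
  split_ifs with h
  · simp
  · rw [not_or] at h
    rw [zetaSh_eq_zetaSt hk h.1, zetaSh_eq_zetaSt hl h.2]

end

end EulerSum

/-- The regularized polynomials are well defined, and the regularized double shuffle relation for
generating functions of Euler sums holds in every weight `w > d + d'`, as an identity in `ℝ[T]`. -/
theorem theorem2p4 :
    (∀ l : List (ℕ × ℤˣ), (∀ p ∈ l, 1 ≤ p.1) →
      (∃! P : Polynomial ℝ, EulerSum.IsStuffleReg l P) ∧
      (∃! P : Polynomial ℝ, EulerSum.IsShuffleReg l P)) ∧
    ∀ (w d d' : ℕ), 1 ≤ d → 1 ≤ d' → d + d' < w →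
      ∀ (μ : Fin d → ℤˣ) (ν : Fin d' → ℤˣ) (x : Fin d → ℝ) (y : Fin d' → ℝ),
        EulerSum.shuffleSide w
            (EulerSum.pairs x (EulerSum.pSign μ)) (EulerSum.pairs y (EulerSum.pSign ν))
          - EulerSum.modTerms EulerSum.zetaSh w x μ y ν
        = EulerSum.stuffleSide w (EulerSum.pairs x μ) (EulerSum.pairs y ν)
          - EulerSum.modTerms EulerSum.zetaSt w x μ y ν := by
  refine ⟨fun l hl => ⟨EulerSum.existsUnique_isStuffleReg l hl,
    EulerSum.existsUnique_isShuffleReg l hl⟩, fun w d d' _ _ _ μ ν x y => ?_⟩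
  rw [EulerSum.shuffleSide_eq, EulerSum.stuffleSide_eq, EulerSum.modTerms, EulerSum.modTerms]
  simp only [← Finset.sum_sub_distrib]
  refine Finset.sum_congr rfl fun m _ => Finset.sum_congr rfl fun s hs =>
    Finset.sum_congr rfl fun t ht => ?_
  -- Both sides are now sums over the same `s`, `t`, with each product weighted by `1 - δ`.
  linear_combination Polynomial.C ((∏ i, x i ^ (s i - 1)) * ∏ j, y j ^ (t j - 1)) *
    EulerSum.delta_mul_eq (EulerSum.one_le_of_mem_pairs hs μ) (EulerSum.one_le_of_mem_pairs ht ν)
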